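/- Conventions. A lattice path is a word in the letters $N$ (north) and $E$ (east), read as unit steps starting at $(0,0)$. Let $P=p_1\cdots p_n$ and $Q=q_1\cdots q_n$ be lattice paths from $(0,0)$ to a common endpoint $(m,r)$, with $P$ never going above $Q$. Let the north steps of $P$ be $p_{u_1},\dots,p_{u_r}$ with $u_1<\cdots<u_r$, let those of $Q$ be $q_{l_1},\dots,q_{l_r}$ with $l_1<\cdots<l_r$, and put $N_i=\{l_i,l_i+1,\dots,u_i\}$. Then $M[P,Q]$ is the transversal matroid on $[n]=\{1,\dots,n\}$ with presentation $(N_1,\dots,N_r)$, that is, its independent sets are the partial transversals of $(N_1,\dots,N_r)$. A lattice path matroid is a matroid isomorphic to some $M[P,Q]$; its ground set is always identified with $[n]$ through such an isomorphism, and so is linearly ordered. A transversal matroid is fundamental if it has a presentation $(A_1,\dots,A_s)$ such that each $A_i$ has an element that is in no $A_j$ with $j\neq i$. A cyclic flat is a flat that is a (possibly empty) union of circuits. A pair $(X,Y)$ of sets is modular if $r(X)+r(Y)=r(X\cup Y)+r(X\cap Y)$. The connected components of a matroid are the classes of the equivalence relation on its ground set in which $e$ and $f$ are related if $e=f$ or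 some circuit contains both. The restriction of a lattice path matroid to a connected component, with the induced order on its ground set, is again a connected lattice path matroid. For a connected lattice path matroid $M[P,Q]$ on $[n]$, an initial connected flat is a set $A=\{1,\dots,a\}$ where steps $a$ and $a+1$ of $Q$ are east and north, respectively; let $(a_1,a_2)$ be the point at which these two steps meet. A final connected flat is a set $B=\{b,\dots,n\}$ where steps $b-1$ and $b$ of $P$ are north and east, respectively; let $(b_1,b_2)$ be the point at which these two steps meet. The pair $(A,B)$ is mixed if $a_1<b_1$ and $a_2>b_2$. Statement. For a lattice path matroid $M$, the following statements are equivalent: (1) $M$ is a fundamental transversal matroid; (2) each pair of cyclic flats of $M$ is modular; (3) no restriction of $M$ to any of its connected components has a mixed pair $(A,B)$ of an initial connected flat $A$ and a final connected flat $B$. -/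

import Mathlib

/-! ### Cyclic flats, modular pairs, connected components -/

namespace Matroid

/-- A cyclic set of a matroid is a (possibly empty) union of circuits. -/
def IsCyclic {α : Type*} (M : Matroid α) (X : Set α) : Prop :=
  ∃ S : Set (Set α), (∀ C ∈ S, M.IsCircuit C) ∧ X = ⋃₀ S

/-- A cyclic flat is a flat that is cyclic. -/
def IsCyclicFlat {α : Type*} (M : Matroid α) (X : Set α) : Prop :=
  M.IsFlat X ∧ M.IsCyclic X

/-- A pair `(X, Y)` of sets is modular if `r(X) + r(Y) = r(X ∪ Y) + r(X ∩ Y)`. -/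
def IsModularPair {α : Type*} (M : Matroid α) (X Y : Set α) : Prop :=
  M.eRk X + M.eRk Y = M.eRk (X ∪ Y) + M.eRk (X ∩ Y)

/-- Two elements are related if they are equal or lie in a common circuit. -/
def InCommonCircuit {α : Type*} (M : Matroid α) (x y : α) : Prop :=
  x = y ∨ ∃ C, M.IsCircuit C ∧ x ∈ C ∧ y ∈ C

/-- The connected components of a matroid are the classes of the relation `InCommonCircuit`
on the ground set. -/
def IsConnectedComponent {α : Type*} (M : Matroid α) (X : Set α) : Prop :=
  ∃ x ∈ M.E, X = {y | y ∈ M.E ∧ M.InCommonCircuit x y}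

end Matroid

/-! ### Transversal matroids -/

/-- `I` is a partial transversal of the set system `A` if there is an injection `φ` from `I` to
the index set of `A` with `x ∈ A (φ x)` for all `x ∈ I`. -/
def IsPartialTransversal {α ι : Type*} (A : ι → Set α) (I : Set α) : Prop :=
  ∃ φ : I → ι, Function.Injective φ ∧ ∀ x : I, (x : α) ∈ A (φ x)

theorem IsPartialTransversal.empty {α ι : Type*} (A : ι → Set α) :
    IsPartialTransversal A ∅ :=
  ⟨fun x => x.2.elim, fun x => x.2.elim, fun x => x.2.elim⟩

theorem IsPartialTransversal.subset {α ι : Type*} {A : ι → Set α} {I J : Set α}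
    (hJ : IsPartialTransversal A J) (hIJ : I ⊆ J) : IsPartialTransversal A I := by
  obtain ⟨φ, hφ, h⟩ := hJ
  exact ⟨fun x => φ ⟨x, hIJ x.2⟩, fun x y hxy => Subtype.ext (by simpa using hφ hxy),
    fun x => h ⟨x, hIJ x.2⟩⟩

/-- The augmentation property: among the matchings of `I`, take one that agrees as often as
possible with a fixed matching of `J`. -/
theorem IsPartialTransversal.augment {α ι : Type*} {A : ι → Set α} {I J : Set α}
    (hIfin : I.Finite)
    (hI : IsPartialTransversal A I) (hJ : IsPartialTransversal A J) (hlt : I.ncard < J.ncard) :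
    ∃ e ∈ J, e ∉ I ∧ IsPartialTransversal A (insert e I) := by
  classical
  obtain ⟨ψ, hψ, hψA⟩ := hJ
  have : Finite I := hIfin
  have : Finite J := Set.finite_of_ncard_pos (by omega)
  let agree : (I → ι) → Set I := fun φ => {x | ∃ h : (x : α) ∈ J, φ x = ψ ⟨x, h⟩}
  let T : Set (I → ι) := {φ | Function.Injective φ ∧ ∀ x : I, (x : α) ∈ A (φ x)}
  have hbdd : ((fun φ => (agree φ).ncard) '' T).Finite := by
    refine (Set.finite_Iic (Nat.card I)).subset ?_
    rintro _ ⟨φ, -, rfl⟩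
    exact Set.ncard_le_card _
  obtain ⟨φ, ⟨hφ, hφA⟩, hmax⟩ := Set.exists_max_image
    ((fun φ => (agree φ).ncard) '' T) id hbdd (by
      obtain ⟨φ, hφ⟩ := hI
      exact ⟨_, φ, hφ, rfl⟩) |>.imp (fun k hk => hk) |> fun ⟨k, ⟨φ, hφ, hk⟩, hm⟩ =>
        (⟨φ, hφ, fun φ' hφ' => by
          have := hm _ ⟨φ', hφ', rfl⟩
          simp only [id] at this
          rw [← hk] at this
          exact this⟩ : ∃ φ, φ ∈ T ∧ ∀ φ' ∈ T, (agree φ').ncard ≤ (agree φ).ncard)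
  obtain ⟨y, hy⟩ : ∃ y : J, ψ y ∉ Set.range φ := by
    by_contra! hcon
    have h1 : (Set.range ψ).ncard ≤ (Set.range φ).ncard :=
      Set.ncard_le_ncard (by rintro _ ⟨y, rfl⟩; exact hcon y) (Set.finite_range φ)
    rw [Set.ncard_range_of_injective hφ, Set.ncard_range_of_injective hψ] at h1
    exact absurd h1 (by simpa [Nat.card_coe_set_eq] using hlt)
  by_cases hyI : (y : α) ∈ I
  · exfalso
    let y' : I := ⟨y, hyI⟩
    let φ' : I → ι := Function.update φ y' (ψ y)
    have hne : ∀ x, φ x ≠ ψ y := fun x hx => hy ⟨x, hx⟩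
    have hT : φ' ∈ T := by
      refine ⟨fun x z hxz => ?_, fun x => ?_⟩
      · by_cases hx : x = y' <;> by_cases hz : z = y'
        · rw [hx, hz]
        · simp only [φ', hx, Function.update_self, Function.update_of_ne hz] at hxz
          exact absurd hxz.symm (hne z)
        · simp only [φ', hz, Function.update_self, Function.update_of_ne hx] at hxz
          exact absurd hxz (hne x)
        · simp only [φ', Function.update_of_ne hx, Function.update_of_ne hz] at hxz
          exact hφ hxz
      · by_cases hx : x = y'
        · subst hx
          simpa only [φ', Function.update_self] using hψA y
        · simpa only [φ', Function.update_of_ne hx] using hφA x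
    have hss : agree φ ⊂ agree φ' := by
      refine ⟨fun x => ?_, fun hsub => ?_⟩
      · rintro ⟨hxJ, hx⟩
        refine ⟨hxJ, ?_⟩
        have hxy : x ≠ y' := by
          rintro rfl
          exact hne _ hx
        simpa only [φ', Function.update_of_ne hxy] using hx
      · obtain ⟨_, h⟩ := hsub (show y' ∈ agree φ' from
          ⟨y.2, by simp only [φ', Function.update_self, y']⟩)
        exact hne _ h
    exact absurd (hmax φ' hT) (not_le.2 (Set.ncard_lt_ncard hss (Set.toFinite _)))
  · refine ⟨y, y.2, hyI, fun x => if hx : (x : α) ∈ I then φ ⟨x, hx⟩ else ψ y, ?_, ?_⟩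
    · intro x z hxz
      by_cases hx : (x : α) ∈ I <;> by_cases hz : (z : α) ∈ I
      · simp only [hx, hz, dif_pos] at hxz
        exact Subtype.ext (by simpa using hφ hxz)
      · simp only [hx, hz, dif_pos, dif_neg, not_false_iff] at hxz
        exact absurd ⟨_, hxz⟩ hy
      · simp only [hx, hz, dif_pos, dif_neg, not_false_iff] at hxz
        exact absurd ⟨_, hxz.symm⟩ hy
      · exact Subtype.ext ((x.2.resolve_right hx).trans (z.2.resolve_right hz).symm)
    · intro x
      by_cases hx : (x : α) ∈ I
      · simpa only [hx, dif_pos] using hφA ⟨x, hx⟩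
      · have hxy : (x : α) = y := x.2.resolve_right hx
        simp only [hx, dif_neg, not_false_iff]
        rw [hxy]
        exact hψA y

/-- The transversal matroid on the finite set `E` with presentation `A`: its independent sets are
the partial transversals of `A` that are contained in `E`. -/
def transversalMatroid {α ι : Type*} (E : Set α) (hE : E.Finite) (A : ι → Set α) : Matroid α :=
  (IndepMatroid.ofFinite hE (fun I => I ⊆ E ∧ IsPartialTransversal A I)
    ⟨Set.empty_subset E, IsPartialTransversal.empty A⟩
    (fun _ _ hJ hIJ => ⟨hIJ.trans hJ.1, hJ.2.subset hIJ⟩)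
    (fun _ _ hI hJ hlt => by
      obtain ⟨e, heJ, heI, he⟩ :=
        hI.2.augment (hE.subset hI.1) hJ.2 hlt
      exact ⟨e, heJ, heI, Set.insert_subset (hJ.1 heJ) hI.1, he⟩)
    (fun _ hI => hI.1)).matroid

theorem transversalMatroid_indep_iff {α ι : Type*} (E : Set α) (hE : E.Finite) (A : ι → Set α)
    (I : Set α) :
    (transversalMatroid E hE A).Indep I ↔ I ⊆ E ∧ IsPartialTransversal A I :=
  Iff.rfl

theorem transversalMatroid_ground {α ι : Type*} (E : Set α) (hE : E.Finite) (A : ι → Set α) :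
    (transversalMatroid E hE A).E = E :=
  rfl

namespace Matroid

/-- The set system `A` on the ground set of `M` is a presentation of `M`: the independent sets of
`M` are exactly the partial transversals of `A`. -/
def IsPresentation {α ι : Type*} (M : Matroid α) (A : ι → Set α) : Prop :=
  (∀ i, A i ⊆ M.E) ∧ ∀ I, M.Indep I ↔ IsPartialTransversal A I

/-- `M` is a fundamental transversal matroid: it has a presentation `(A_1, …, A_r)` in which
each `A_i` has an element that is in no `A_j` with `j ≠ i`. -/
def IsFundamentalTransversal {α : Type*} (M : Matroid α) : Prop :=
  ∃ (r : ℕ) (A : Fin r → Set α), M.IsPresentation A ∧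
    ∀ i, ∃ x ∈ A i, ∀ j, j ≠ i → x ∉ A j

end Matroid

/-! ### Lattice path matroids -/

/-- A step of a lattice path: north or east. -/
inductive LatticeStep
  | N
  | E
  deriving DecidableEq

/-- A lattice path starting at `(0, 0)`, as a word `w_1 w_2 … w_n` in the letters `N` and `E`. -/
abbrev LatticePath := List LatticeStep

namespace LatticePath

/-- The `k`-th letter `w_k` of the word, where `k = 1, …, n`. -/
def step : LatticePath → ℕ → Option LatticeStep
  | _, 0 => none
  | w, k + 1 => w[k]?

/-- The first coordinate of the point that the path reaches after `k` steps. -/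
def xCoord (w : LatticePath) (k : ℕ) : ℕ := (w.take k).count LatticeStep.E

/-- The second coordinate of the point that the path reaches after `k` steps. -/
def yCoord (w : LatticePath) (k : ℕ) : ℕ := (w.take k).count LatticeStep.N

/-- The position `k ∈ {1, …, n}` of the north step of the path that has exactly `i` north steps
before it (so `i = 0` gives the first north step). -/
noncomputable def northPos (w : LatticePath) (i : ℕ) : ℕ :=
  Nat.nth (fun k => w.step k = some LatticeStep.N) i

end LatticePath

/-- Two lattice paths `P` and `Q` from `(0, 0)` to a common endpoint, with `P` never going above
`Q`.  (The points reached after `k` steps lie on the same antidiagonal, so it is enough to compare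
second coordinates.) -/
structure LatticePathPair where
  P : LatticePath
  Q : LatticePath
  count_E_eq : P.count LatticeStep.E = Q.count LatticeStep.E
  count_N_eq : P.count LatticeStep.N = Q.count LatticeStep.N
  not_above : ∀ k, P.yCoord k ≤ Q.yCoord k

namespace LatticePathPair

/-- The common length `n` of the paths. -/
def n (D : LatticePathPair) : ℕ := D.P.length

/-- The common number `r` of north steps of the paths. -/
def r (D : LatticePathPair) : ℕ := D.P.count LatticeStep.N

/-- The intervals `N_i = [l_i, u_i]` of the path presentation (indexed from `0`), where `l_i` and
`u_i` are the positions of the `i`-th north steps of `Q` and of `P`. -/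
noncomputable def pathPresentation (D : LatticePathPair) (i : Fin D.r) : Set ℕ :=
  Set.Icc (D.Q.northPos i) (D.P.northPos i)

/-- The matroid `M[P, Q]` on `[n] = {1, …, n}`. -/
noncomputable def matroid (D : LatticePathPair) : Matroid ℕ :=
  transversalMatroid (Set.Icc 1 D.n) (Set.finite_Icc 1 D.n) D.pathPresentation

/-- Steps `a` and `a + 1` of `Q` form an `EN` corner of `Q`. -/
def IsENCorner (D : LatticePathPair) (a : ℕ) : Prop :=
  D.Q.step a = some LatticeStep.E ∧ D.Q.step (a + 1) = some LatticeStep.N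

/-- Steps `b - 1` and `b` of `P` form an `NE` corner of `P`. -/
def IsNECorner (D : LatticePathPair) (b : ℕ) : Prop :=
  D.P.step (b - 1) = some LatticeStep.N ∧ D.P.step b = some LatticeStep.E

/-- For a pair of paths with `M[P, Q]` connected: the initial connected flat `A = [a]` that comes
from an `EN` corner `(a₁, a₂)` of `Q` and the final connected flat `B = [b, n]` that comes from an
`NE` corner `(b₁, b₂)` of `P` are a mixed pair, that is, `a₁ < b₁` and `a₂ > b₂`. -/
def IsMixedPair (D : LatticePathPair) (A B : Set ℕ) : Prop :=
  ∃ a b, D.IsENCorner a ∧ A = Set.Icc 1 a ∧ D.IsNECorner b ∧ B = Set.Icc b D.n ∧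
    D.Q.xCoord a < D.P.xCoord (b - 1) ∧ D.P.yCoord (b - 1) < D.Q.yCoord a

end LatticePathPair

namespace Matroid

/-- `M` is the lattice path matroid `M[P, Q]`, when its linearly ordered ground set is identified
with `[n]` in the order-preserving way. -/
def IsLatticePathMatroidOf {α : Type*} [LinearOrder α] (M : Matroid α) (D : LatticePathPair) :
    Prop :=
  ∃ e : D.matroid.E ≃o M.E, ∀ I : Set D.matroid.E,
    D.matroid.Indep (Subtype.val '' I) ↔ M.Indep (Subtype.val '' (e '' I))

/-- `M`, with its linearly ordered ground set, is a lattice path matroid. -/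
def IsLatticePathMatroid {α : Type*} [LinearOrder α] (M : Matroid α) : Prop :=
  ∃ D : LatticePathPair, M.IsLatticePathMatroidOf D

/-- The (connected) lattice path matroid `M` has a mixed pair of an initial and a final connected
flat in its diagram. -/
def HasMixedPair {α : Type*} [LinearOrder α] (M : Matroid α) : Prop :=
  ∃ D : LatticePathPair, M.IsLatticePathMatroidOf D ∧ ∃ A B, D.IsMixedPair A B

end Matroid

/-! Everything is expressed through the heights `yCoord` of the paths: `x` may be matched to the
index `i` (counted from 0) exactly when `P.yCoord (x - 1) ≤ i < Q.yCoord x`.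

(1) ⇒ (2): let `x i` be a private element of `A i`. A cyclic flat that meets `A i` contains `x i`
(`private_mem_closure_of_isCircuit`), and this property passes to unions and intersections. For sets
with this property the rank is the number of private elements inside (`eRk_eq_of_private`), so
modularity is inclusion–exclusion.

(2) ⇒ (3): in a component, a mixed pair gives cyclic sets `A = [a]` and `B = [b, n]` whose closures
in `M` add only loops. Their ranks are at least `Q(a)` and `r - P(b-1)`, while `r(A ∪ B) ≤ r` and
`r(A ∩ B) ≤ |A ∩ B|`. The mixed inequalities say exactly that these bounds contradict modularity
(`not_hasMixedPair`).

(3) ⇒ (1): a mixed pair of the whole diagram lies between two consecutive meeting points of the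
paths, hence in one component, so there is none (`not_exists_isMixedPair`). Then some path `R`
between `P` and `Q` passes through every `EN` corner of `Q` and every `NE` corner of `P`
(`exists_isCornerPath`). Its north steps form a basis, and the sets of elements exchangeable for
each of them present the matroid, with those north steps as private elements
(`IsCornerPath.isPresentation`). This works because a basis is constrained only at the corners,
where `R` touches the boundary. -/

theorem isPartialTransversal_fin_iff {α : Type*} {r : ℕ} (A : ℕ → Set α) {I : Set α} :
    IsPartialTransversal (fun i : Fin r => A i) I ↔
      ∃ φ : α → ℕ, Set.InjOn φ I ∧ ∀ x ∈ I, φ x < r ∧ x ∈ A (φ x) := by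
  classical
  constructor
  · rintro ⟨φ, hφ, h⟩
    refine ⟨fun x => if hx : x ∈ I then φ ⟨x, hx⟩ else 0, fun x hx y hy hxy => ?_, fun x hx => ?_⟩
    · simp only [hx, hy, dif_pos] at hxy
      exact congrArg Subtype.val (hφ (Fin.ext hxy))
    · simpa only [hx, dif_pos] using ⟨(φ ⟨x, hx⟩).2, h ⟨x, hx⟩⟩
  · rintro ⟨φ, hφ, h⟩
    exact ⟨fun x => ⟨φ x, (h x x.2).1⟩,
      fun x y hxy => Subtype.ext (hφ x.2 y.2 (by simpa using hxy)), fun x => (h x x.2).2⟩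

/-! ### Heights of lattice paths and the matching criterion for independence -/

namespace LatticePath

theorem step_of_one_le {w : LatticePath} {k : ℕ} (hk : 1 ≤ k) : w.step k = w[k - 1]? := by
  obtain ⟨k, rfl⟩ := Nat.exists_eq_add_of_le' hk
  rfl

@[simp]
theorem yCoord_zero (w : LatticePath) : w.yCoord 0 = 0 := by simp [yCoord]

@[simp]
theorem xCoord_zero (w : LatticePath) : w.xCoord 0 = 0 := by simp [xCoord]

theorem yCoord_succ (w : LatticePath) (k : ℕ) :
    w.yCoord (k + 1) = w.yCoord k + if w.step (k + 1) = some LatticeStep.N then 1 else 0 := by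
  unfold yCoord step
  rw [List.take_add_one, List.count_append]
  cases h : w[k]? with
  | none => simp [h]
  | some s => cases s <;> simp [h]

theorem xCoord_succ (w : LatticePath) (k : ℕ) :
    w.xCoord (k + 1) = w.xCoord k + if w.step (k + 1) = some LatticeStep.E then 1 else 0 := by
  unfold xCoord step
  rw [List.take_add_one, List.count_append]
  cases h : w[k]? with
  | none => simp [h]
  | some s => cases s <;> simp [h]

theorem yCoord_le_succ (w : LatticePath) (k : ℕ) : w.yCoord k ≤ w.yCoord (k + 1) := by
  rw [yCoord_succ]; omega

theorem yCoord_succ_le (w : LatticePath) (k : ℕ) : w.yCoord (k + 1) ≤ w.yCoord k + 1 := by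
  rw [yCoord_succ]; split <;> omega

theorem yCoord_mono (w : LatticePath) : Monotone w.yCoord :=
  monotone_nat_of_le_succ w.yCoord_le_succ

theorem yCoord_of_length_le {w : LatticePath} {k : ℕ} (hk : w.length ≤ k) :
    w.yCoord k = w.count LatticeStep.N := by
  rw [yCoord, List.take_of_length_le hk]

theorem step_eq_none {w : LatticePath} {k : ℕ} (hk : w.length < k) : w.step k = none := by
  rw [step_of_one_le (by omega)]
  simp; omega

theorem step_ne_none {w : LatticePath} {k : ℕ} (h1 : 1 ≤ k) (hk : k ≤ w.length) :
    w.step k ≠ none := by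
  rw [step_of_one_le h1]
  simp; omega

theorem xCoord_add_yCoord {w : LatticePath} {k : ℕ} (hk : k ≤ w.length) :
    w.xCoord k + w.yCoord k = k := by
  induction k with
  | zero => simp
  | succ k ih =>
    have h := step_ne_none (w := w) (k := k + 1) (by omega) hk
    have := ih (by omega)
    rw [xCoord_succ, yCoord_succ]
    match h' : w.step (k + 1) with
    | none => exact absurd h' h
    | some .N => simp; omega
    | some .E => simp; omega

theorem step_eq_N_iff {w : LatticePath} {k : ℕ} :
    w.step k = some LatticeStep.N ↔ 1 ≤ k ∧ w.yCoord k = w.yCoord (k - 1) + 1 := by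
  cases k with
  | zero => simp [step]
  | succ k =>
    rw [yCoord_succ]
    by_cases h : w.step (k + 1) = some LatticeStep.N <;> simp [h]

theorem step_eq_E_iff {w : LatticePath} {k : ℕ} :
    w.step k = some LatticeStep.E ↔
      1 ≤ k ∧ k ≤ w.length ∧ w.yCoord k = w.yCoord (k - 1) := by
  constructor
  · intro h
    refine ⟨?_, ?_, ?_⟩
    · rcases k with _ | k
      · simp [step] at h
      · omega
    · by_contra! hk
      rw [step_eq_none hk] at h
      simp at h
    · rcases k with _ | k
      · simp [step] at h
      · rw [yCoord_succ]; simp [h]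
  · rintro ⟨h1, h2, h3⟩
    match h' : w.step k with
    | none => exact absurd h' (step_ne_none h1 h2)
    | some .N => have := (step_eq_N_iff.1 h').2; omega
    | some .E => rfl

/-- `Nat.count` at `k + 1` counts the positions `0, …, k`, and position `0` carries no step. This
ties `northPos`, an instance of `Nat.nth`, to heights. -/
theorem yCoord_eq_count (w : LatticePath) (k : ℕ) :
    w.yCoord k = Nat.count (fun j => w.step j = some LatticeStep.N) (k + 1) := by
  induction k with
  | zero => simp [Nat.count_succ, step]
  | succ k ih => rw [yCoord_succ, Nat.count_succ, ih]

theorem lt_card_of_lt_count {w : LatticePath} {i : ℕ} (hi : i < w.count LatticeStep.N)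
    (hf : (Set.ofPred fun j => w.step j = some LatticeStep.N).Finite) :
    i < hf.toFinset.card := by
  refine hi.trans_le ?_
  rw [← yCoord_of_length_le le_rfl, yCoord_eq_count]
  exact Nat.count_le_card hf _

theorem northPos_le_iff {w : LatticePath} {i k : ℕ} (hi : i < w.count LatticeStep.N) :
    w.northPos i ≤ k ↔ i < w.yCoord k := by
  rw [yCoord_eq_count]
  constructor
  · intro h
    have := Nat.count_nth_succ (p := fun j => w.step j = some LatticeStep.N)
      (n := i) (lt_card_of_lt_count hi)
    have h2 := Nat.count_monotone (fun j => w.step j = some LatticeStep.N)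
      (Nat.succ_le_succ h)
    simp only [northPos, Nat.succ_eq_add_one] at h2
    omega
  · intro h
    exact Nat.lt_succ_iff.1 (Nat.nth_lt_of_lt_count h)

end LatticePath

namespace LatticePathPair

variable (D : LatticePathPair)

theorem length_Q : D.Q.length = D.n := by
  have h (w : LatticePath) : w.length = w.count LatticeStep.E + w.count LatticeStep.N := by
    have := LatticePath.xCoord_add_yCoord (w := w) le_rfl
    simp only [LatticePath.xCoord, LatticePath.yCoord, List.take_length] at this
    exact this.symm
  rw [n, h, h, D.count_E_eq, D.count_N_eq]

theorem yP_of_le {k : ℕ} (hk : D.n ≤ k) : D.P.yCoord k = D.r :=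
  LatticePath.yCoord_of_length_le hk

theorem yQ_of_le {k : ℕ} (hk : D.n ≤ k) : D.Q.yCoord k = D.r := by
  rw [LatticePath.yCoord_of_length_le (D.length_Q.trans_le hk), ← D.count_N_eq, r]

theorem yP_le_r (k : ℕ) : D.P.yCoord k ≤ D.r := by
  rw [← D.yP_of_le (le_max_left D.n k)]
  exact D.P.yCoord_mono (le_max_right _ _)

theorem yQ_le_r (k : ℕ) : D.Q.yCoord k ≤ D.r := by
  rw [← D.yQ_of_le (le_max_left D.n k)]
  exact D.Q.yCoord_mono (le_max_right _ _)

/-- The `i`-th north step of `Q` is at or before `x` when `Q` has more than `i` north steps by then;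
that of `P` is at or after `x` when `P` has at most `i` before `x`. -/
theorem mem_pathPresentation_iff (i : Fin D.r) (x : ℕ) :
    x ∈ D.pathPresentation i ↔ 1 ≤ x ∧ D.P.yCoord (x - 1) ≤ i ∧ i < D.Q.yCoord x := by
  have hQ : (i : ℕ) < D.Q.count LatticeStep.N := by rw [← D.count_N_eq]; exact i.2
  rw [pathPresentation, Set.mem_Icc, LatticePath.northPos_le_iff hQ]
  have hP (k : ℕ) := LatticePath.northPos_le_iff (w := D.P) (k := k) i.2
  rcases x with _ | x
  · simp
  · have := hP x
    simp only [Nat.add_sub_cancel]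
    constructor
    · rintro ⟨h1, h2⟩
      refine ⟨by omega, ?_, h1⟩
      by_contra! hlt
      have := this.2 hlt
      omega
    · rintro ⟨-, h1, h2⟩
      refine ⟨h2, ?_⟩
      by_contra! hlt
      have := this.1 (by omega)
      omega

theorem indep_iff {I : Set ℕ} : D.matroid.Indep I ↔ ∃ φ : ℕ → ℕ, Set.InjOn φ I ∧
    ∀ x ∈ I, 1 ≤ x ∧ D.P.yCoord (x - 1) ≤ φ x ∧ φ x < D.Q.yCoord x := by
  have hA : D.pathPresentation =
      fun i : Fin D.r => {x | 1 ≤ x ∧ D.P.yCoord (x - 1) ≤ i ∧ i < D.Q.yCoord x} :=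
    funext fun i => Set.ext fun x => D.mem_pathPresentation_iff i x
  rw [matroid, transversalMatroid_indep_iff, hA,
    isPartialTransversal_fin_iff fun i => {x | 1 ≤ x ∧ D.P.yCoord (x - 1) ≤ i ∧ i < D.Q.yCoord x}]
  constructor
  · rintro ⟨-, φ, hφ, h⟩
    exact ⟨φ, hφ, fun x hx => (h x hx).2⟩
  · rintro ⟨φ, hφ, h⟩
    refine ⟨fun x hx => ⟨(h x hx).1, ?_⟩, φ, hφ,
      fun x hx => ⟨(h x hx).2.2.trans_le (D.yQ_le_r x), h x hx⟩⟩
    -- Beyond `n` the height of `P` is already `r`, so no index is available; containment in `[n]`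
    -- is automatic.
    by_contra! hlt
    have h1 := D.yP_of_le (k := x - 1) (by omega)
    have h2 := h x hx
    have h3 := D.yQ_le_r x
    omega

theorem ground_eq : D.matroid.E = Set.Icc 1 D.n := rfl

end LatticePathPair

/-! ### Circuits, cyclic flats and connected components -/

namespace Matroid

variable {α : Type*}

theorem InCommonCircuit.symm {M : Matroid α} {x y : α} (h : M.InCommonCircuit x y) :
    M.InCommonCircuit y x := by
  rcases h with rfl | ⟨C, hC, hx, hy⟩
  · exact Or.inl rfl
  · exact Or.inr ⟨C, hC, hy, hx⟩

/-- If no circuit contains both `x` and `z`, take meeting circuits `A ∋ x`, `B ∋ z` with `|A ∪ B|`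
least and eliminate a common element `w` in both ways, getting `C ∋ x` and `C' ∋ z`. Minimality for
`(A, C')` forces `C` and `C'` to meet, and then `(C, C')` contradicts minimality since its union
misses `w`. -/
theorem InCommonCircuit.trans {M : Matroid α} [M.Finitary] {x y z : α}
    (hxy : M.InCommonCircuit x y) (hyz : M.InCommonCircuit y z) : M.InCommonCircuit x z := by
  classical
  rcases hxy with rfl | ⟨C₁, hC₁, hx₁, hy₁⟩
  · exact hyz
  rcases hyz with rfl | ⟨C₂, hC₂, hy₂, hz₂⟩
  · exact Or.inr ⟨C₁, hC₁, hx₁, hy₁⟩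
  by_contra hcon
  have hno : ∀ C, M.IsCircuit C → x ∈ C → z ∈ C → False :=
    fun C hC hx hz => hcon (Or.inr ⟨C, hC, hx, hz⟩)
  let T : Set (Set α × Set α) := {p | M.IsCircuit p.1 ∧ M.IsCircuit p.2 ∧ x ∈ p.1 ∧ z ∈ p.2 ∧
    (p.1 ∩ p.2).Nonempty}
  obtain ⟨⟨A, B⟩, ⟨hA, hB, hxA, hzB, w, hwA, hwB⟩, hmin⟩ :=
    exists_minimalFor_of_wellFoundedLT (fun p => p ∈ T) (fun p => (p.1 ∪ p.2).ncard)
      ⟨(C₁, C₂), hC₁, hC₂, hx₁, hz₂, y, hy₁, hy₂⟩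
  have hfin : (A ∪ B).Finite := hA.finite.union hB.finite
  have hlow : ∀ A' B', (A', B') ∈ T → A' ∪ B' ⊆ A ∪ B → A' ∪ B' = A ∪ B := by
    intro A' B' h hsub
    by_contra hne
    have hlt := Set.ncard_lt_ncard (hsub.ssubset_of_ne hne) hfin
    have := hmin h hlt.le
    exact absurd this (not_le.2 hlt)
  have hxB : x ∉ B := fun h => hno B hB h hzB
  have hzA : z ∉ A := fun h => hno A hA hxA h
  obtain ⟨C, hCs, hC, hxC⟩ := hA.strong_elimination hB hwA hwB hxA hxB
  obtain ⟨C', hCs', hC', hzC'⟩ := hB.strong_elimination hA hwB hwA hzB hzA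
  rw [Set.union_comm] at hCs'
  have hCsub : C ⊆ A ∪ B := hCs.trans Set.sdiff_subset
  have hCsub' : C' ⊆ A ∪ B := hCs'.trans Set.sdiff_subset
  obtain ⟨c, hcC, hcA⟩ : ∃ c ∈ C, c ∉ A := by
    by_contra! h
    rw [hC.eq_of_subset_isCircuit hA h] at hCs
    exact (hCs hwA).2 rfl
  obtain ⟨c', hcC', hcB'⟩ : ∃ c ∈ C', c ∉ B := by
    by_contra! h
    rw [hC'.eq_of_subset_isCircuit hB h] at hCs'
    exact (hCs' hwB).2 rfl
  have hcB : c ∈ B := (hCsub hcC).resolve_left hcA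
  have hcA' : c' ∈ A := (hCsub' hcC').resolve_right hcB'
  have h1 := hlow A C' ⟨hA, hC', hxA, hzC', c', hcA', hcC'⟩
    (Set.union_subset Set.subset_union_left hCsub')
  have hcC'' : c ∈ C' := by
    have : c ∈ A ∪ C' := h1 ▸ hCsub hcC
    exact this.resolve_left hcA
  have h2 := hlow C C' ⟨hC, hC', hxC, hzC', c, hcC, hcC''⟩ (Set.union_subset hCsub hCsub')
  have : w ∈ C ∪ C' := h2 ▸ Or.inl hwA
  rcases this with h | h
  · exact (hCs h).2 rfl
  · exact (hCs' h).2 rfl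

theorem IsCyclic.isCyclicFlat_closure {M : Matroid α} {X : Set α} (hX : M.IsCyclic X) :
    M.IsCyclicFlat (M.closure X) := by
  obtain ⟨S, hS, rfl⟩ := hX
  refine ⟨M.isFlat_closure _, {C | M.IsCircuit C ∧ C ⊆ M.closure (⋃₀ S)}, fun C hC => hC.1, ?_⟩
  have hsub : ⋃₀ S ⊆ M.E := Set.sUnion_subset fun C hC => (hS C hC).subset_ground
  refine subset_antisymm (fun e he => ?_) (Set.sUnion_subset fun C hC => hC.2)
  by_cases heS : e ∈ ⋃₀ S
  · obtain ⟨C, hC, heC⟩ := heS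
    exact ⟨C, ⟨hS C hC, (Set.subset_sUnion_of_mem hC).trans (M.subset_closure _ hsub)⟩, heC⟩
  · obtain ⟨C, hCs, hC, heC⟩ := exists_isCircuit_of_mem_closure he heS
    exact ⟨C, ⟨hC, hCs.trans (Set.insert_subset he (M.subset_closure _ hsub))⟩, heC⟩

theorem IsConnectedComponent.subset_ground {M : Matroid α} {X : Set α} (hX : M.IsConnectedComponent X) :
    X ⊆ M.E := by
  obtain ⟨x, -, rfl⟩ := hX
  exact fun y hy => hy.1

theorem IsConnectedComponent.subset_of_isCircuit {M : Matroid α} [M.Finitary] {X C : Set α}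
    (hX : M.IsConnectedComponent X) (hC : M.IsCircuit C) {y : α} (hyC : y ∈ C) (hyX : y ∈ X) :
    C ⊆ X := by
  obtain ⟨x, -, rfl⟩ := hX
  exact fun z hz => ⟨hC.subset_ground hz, hyX.2.trans (Or.inr ⟨C, hC, hyC, hz⟩)⟩

/-- A circuit meeting a component stays inside it, so an element outside `X` can enter the closure
only as a loop. Flats of the restriction are thus flats of `M` up to loops, which do not affect
rank. -/
theorem IsConnectedComponent.closure_subset {M : Matroid α} [M.Finitary] {X Y : Set α}
    (hX : M.IsConnectedComponent X) (hYX : Y ⊆ X) (hY : (M ↾ X).closure Y ⊆ Y) :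
    M.closure Y ⊆ Y ∪ M.loops := by
  intro e he
  by_contra hcon
  rw [Set.mem_union, not_or] at hcon
  by_cases heX : e ∈ X
  · refine hcon.1 (hY ?_)
    rw [restrict_closure_eq M hYX hX.subset_ground]
    exact ⟨he, heX⟩
  · obtain ⟨C, hCs, hC, heC⟩ := exists_isCircuit_of_mem_closure he hcon.1
    by_cases hC1 : C ⊆ {e}
    · rw [Set.Nonempty.subset_singleton_iff hC.nonempty] at hC1
      exact hcon.2 (singleton_isCircuit.1 (hC1 ▸ hC))
    · obtain ⟨y, hyC, hye⟩ := Set.not_subset.1 hC1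
      have hyY : y ∈ Y := (hCs hyC).resolve_left hye
      exact heX (hX.subset_of_isCircuit hC hyC (hYX hyY) heC)

theorem IsCyclic.of_restrict {M : Matroid α} {X Y : Set α} (hX : X ⊆ M.E) (hY : (M ↾ X).IsCyclic Y) :
    M.IsCyclic Y := by
  obtain ⟨S, hS, rfl⟩ := hY
  exact ⟨S, fun C hC => ((restrict_isCircuit_iff hX).1 (hS C hC)).1, rfl⟩

/-! ### Fundamental presentations make cyclic flats modular -/

section Fundamental

variable {M : Matroid α} {ι : Type*} {A : ι → Set α}

theorem IsPresentation.encard_le {I : Set α} (hA : M.IsPresentation A) (hI : M.Indep I)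
    {T : Set ι} (hT : ∀ y ∈ I, ∀ i, y ∈ A i → i ∈ T) : I.encard ≤ T.encard := by
  obtain ⟨φ, hφ, h⟩ := (hA.2 I).1 hI
  let ψ : I → T := fun y => ⟨φ y, hT y y.2 _ (h y)⟩
  have hψ : Function.Injective ψ := fun a b hab => hφ (congrArg Subtype.val hab)
  exact (Function.Embedding.mk ψ hψ).encard_le

/-- An independent subset of `X` can be matched only to indices whose private element lies in `X`,
and those private elements are themselves independent. -/
theorem eRk_eq_of_private (hA : M.IsPresentation A) {x : ι → α} (hx : ∀ i, x i ∈ A i)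
    (hpriv : ∀ i j, j ≠ i → x i ∉ A j) {X : Set α}
    (hX : ∀ y ∈ X, ∀ i, y ∈ A i → x i ∈ X) : M.eRk X = {i | x i ∈ X}.encard := by
  have hinj : Function.Injective x := by
    intro i j hij
    by_contra hne
    exact hpriv i j (Ne.symm hne) (hij ▸ hx j)
  apply le_antisymm
  · rw [eRk_le_iff]
    exact fun I hIX hI => hA.encard_le hI fun y hy i hyi => hX y (hIX hy) i hyi
  · rw [← hinj.encard_image]
    refine Indep.encard_le_eRk_of_subset ((hA.2 _).2 ?_) (Set.image_subset_iff.2 fun i hi => hi)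
    have hch : ∀ y : x '' {i | x i ∈ X}, ∃ i, x i = y := fun y => y.2.imp fun i hi => hi.2
    choose φ hφ using hch
    refine ⟨φ, fun a b hab => Subtype.ext ?_, fun y => ?_⟩
    · rw [← hφ a, ← hφ b, hab]
    · have := hx (φ y)
      rwa [hφ y] at this

/-- Otherwise `C \ {y}` together with `x i` is independent. In a matching of it `x i` must use `i`;
handing `i` over to `y` matches all of `C`. -/
theorem private_mem_closure_of_isCircuit (hA : M.IsPresentation A) {x : ι → α}
    (hx : ∀ i, x i ∈ A i) (hpriv : ∀ i j, j ≠ i → x i ∉ A j) {C : Set α} (hC : M.IsCircuit C)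
    {y : α} (hy : y ∈ C) {i : ι} (hyi : y ∈ A i) : x i ∈ M.closure C := by
  classical
  by_contra hcl
  have hxC : x i ∉ C := fun h => hcl (M.mem_closure_of_mem h)
  rw [← hC.closure_sdiff_singleton_eq y] at hcl
  have hind := hC.sdiff_singleton_indep hy
  have hins : M.Indep (insert (x i) (C \ {y})) :=
    (hind.insert_indep_iff.2 (Or.inl ⟨hA.1 i (hx i), hcl⟩))
  obtain ⟨φ, hφ, h⟩ := (hA.2 _).1 hins
  have hφx : φ ⟨x i, Set.mem_insert _ _⟩ = i := by
    by_contra hne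
    exact hpriv i _ hne (h ⟨x i, Set.mem_insert _ _⟩)
  refine hC.not_indep ((hA.2 C).2 ⟨fun z => if hz : (z : α) = y then i else
    φ ⟨z, Or.inr ⟨z.2, hz⟩⟩, fun a b hab => ?_, fun z => ?_⟩)
  · have key : ∀ z : C, ∀ hz : (z : α) ≠ y, φ ⟨z, Or.inr ⟨z.2, hz⟩⟩ ≠ i := by
      intro z hz heq
      have : (z : α) = x i := congrArg Subtype.val (hφ (heq.trans hφx.symm))
      exact hxC (this ▸ z.2)
    by_cases ha : (a : α) = y <;> by_cases hb : (b : α) = y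
    · exact Subtype.ext (ha.trans hb.symm)
    · simp only [ha, hb, dif_pos, dif_neg, not_false_iff] at hab
      exact absurd hab.symm (key b hb)
    · simp only [ha, hb, dif_pos, dif_neg, not_false_iff] at hab
      exact absurd hab (key a ha)
    · simp only [ha, hb, dif_neg, not_false_iff] at hab
      exact Subtype.ext (congrArg Subtype.val (hφ hab) :)
  · by_cases hz : (z : α) = y
    · simpa only [hz, dif_pos] using hyi
    · simpa only [hz, dif_neg, not_false_iff] using h ⟨z, Or.inr ⟨z.2, hz⟩⟩

theorem IsFundamentalTransversal.isModularPair (hM : M.IsFundamentalTransversal) {X Y : Set α}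
    (hX : M.IsCyclicFlat X) (hY : M.IsCyclicFlat Y) : M.IsModularPair X Y := by
  obtain ⟨r, A, hA, hpriv⟩ := hM
  choose x hx hxp using hpriv
  have key : ∀ X, M.IsCyclicFlat X → ∀ y ∈ X, ∀ i, y ∈ A i → x i ∈ X := by
    rintro X ⟨hXF, S, hS, rfl⟩ y ⟨C, hC, hyC⟩ i hyi
    have := private_mem_closure_of_isCircuit hA hx hxp (hS C hC) hyC hyi
    have h2 := M.closure_subset_closure (Set.subset_sUnion_of_mem hC) this
    rwa [hXF.closure] at h2
  have hXk := key X hX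
  have hYk := key Y hY
  unfold IsModularPair
  rw [eRk_eq_of_private hA hx hxp hXk, eRk_eq_of_private hA hx hxp hYk,
    eRk_eq_of_private hA hx hxp (X := X ∪ Y)
      fun y hy i hi => hy.imp (fun h => hXk y h i hi) (fun h => hYk y h i hi),
    eRk_eq_of_private hA hx hxp (X := X ∩ Y)
      fun y hy i hi => ⟨hXk y hy.1 i hi, hYk y hy.2 i hi⟩]
  exact (Set.encard_union_add_encard_inter {i | x i ∈ X} {i | x i ∈ Y}).symm

end Fundamental

end Matroid

/-! ### North steps, meeting points and circuits of separated path pairs -/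

theorem card_ascents_add {h : ℕ → ℕ} (h1 : ∀ k, h k ≤ h (k + 1)) (h2 : ∀ k, h (k + 1) ≤ h k + 1)
    {j k : ℕ} (hjk : j ≤ k) :
    ((Finset.Ioc j k).filter fun x => h x = h (x - 1) + 1).card + h j = h k := by
  induction k, hjk using Nat.le_induction with
  | base => simp
  | succ k hk ih =>
    rw [← Finset.insert_Ioc_right_eq_Ioc_add_one (by omega), Finset.filter_insert]
    have := h1 k
    have := h2 k
    split_ifs with hs
    · rw [Finset.card_insert_of_notMem (by simp)]
      simp only [Nat.add_sub_cancel] at hs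
      omega
    · simp only [Nat.add_sub_cancel] at hs
      omega

namespace LatticePath

/-- The positions in `(j, k]` of the north steps of a path. -/
def norths (w : LatticePath) (j k : ℕ) : Finset ℕ :=
  (Finset.Ioc j k).filter fun x => w.yCoord x = w.yCoord (x - 1) + 1

theorem mem_norths {w : LatticePath} {j k x : ℕ} :
    x ∈ w.norths j k ↔ (j < x ∧ x ≤ k) ∧ w.yCoord x = w.yCoord (x - 1) + 1 := by
  simp [norths]

theorem card_norths_add {w : LatticePath} {j k : ℕ} (hjk : j ≤ k) :
    (w.norths j k).card + w.yCoord j = w.yCoord k :=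
  card_ascents_add w.yCoord_le_succ w.yCoord_succ_le hjk

theorem yCoord_le (w : LatticePath) {j k : ℕ} (h : j ≤ k) : w.yCoord j ≤ w.yCoord k :=
  w.yCoord_mono h

end LatticePath

namespace LatticePathPair

variable (D : LatticePathPair)

/-- The two paths meet only at their endpoints. -/
def IsSeparated : Prop := ∀ k, 0 < k → k < D.n → D.P.yCoord k < D.Q.yCoord k

variable {D}

/-- Positions up to `k` use indices below the common height at `k`, later positions use indices at
or above it, so the two matchings cannot collide. -/
theorem indep_union_of_meet {k : ℕ} (hk : D.P.yCoord k = D.Q.yCoord k) {I J : Set ℕ}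
    (hI : D.matroid.Indep I) (hJ : D.matroid.Indep J) (hIk : I ⊆ Set.Iic k) (hJk : J ⊆ Set.Ioi k) :
    D.matroid.Indep (I ∪ J) := by
  rw [indep_iff] at hI hJ ⊢
  obtain ⟨φ, hφ, h⟩ := hI
  obtain ⟨ψ, hψ, h'⟩ := hJ
  have hφk : ∀ x ∈ I, φ x < D.Q.yCoord k := fun x hx =>
    (h x hx).2.2.trans_le (D.Q.yCoord_le (hIk hx))
  have hψk : ∀ x ∈ J, D.Q.yCoord k ≤ ψ x := fun x hx => by
    have h1 : k < x := hJk hx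
    have := D.P.yCoord_le (show k ≤ x - 1 by omega)
    have := (h' x hx).2.1
    omega
  have hI' : ∀ x ∈ I, x ≤ k := fun x hx => hIk hx
  have hJ' : ∀ x ∈ J, ¬ x ≤ k := fun x hx => not_le.2 (hJk hx)
  refine ⟨fun x => if x ≤ k then φ x else ψ x, ?_, ?_⟩
  · rintro x (hx | hx) y (hy | hy) hxy
    · simp only [hI' x hx, hI' y hy, if_true] at hxy
      exact hφ hx hy hxy
    · simp only [hI' x hx, hJ' y hy, if_true, if_false] at hxy
      have := hφk x hx
      have := hψk y hy
      omega
    · simp only [hJ' x hx, hI' y hy, if_true, if_false] at hxy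
      have := hφk y hy
      have := hψk x hx
      omega
    · simp only [hJ' x hx, hJ' y hy, if_false] at hxy
      exact hψ hx hy hxy
  · rintro x (hx | hx)
    · simpa only [hI' x hx, if_true] using h x hx
    · simpa only [hJ' x hx, if_false] using h' x hx

theorem IsCircuit.not_cross {k : ℕ} (hk : D.P.yCoord k = D.Q.yCoord k) {C : Set ℕ}
    (hC : D.matroid.IsCircuit C) {x y : ℕ} (hx : x ∈ C) (hy : y ∈ C) (hxk : x ≤ k) : y ≤ k := by
  by_contra! hyk
  refine hC.not_indep ?_
  have h1 : D.matroid.Indep (C ∩ Set.Iic k) :=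
    hC.ssubset_indep ⟨Set.inter_subset_left, fun h => absurd (h hy).2 (not_le.2 hyk)⟩
  have h2 : D.matroid.Indep (C ∩ Set.Ioi k) :=
    hC.ssubset_indep ⟨Set.inter_subset_left, fun h => absurd (h hx).2 (not_lt.2 hxk)⟩
  have := indep_union_of_meet hk h1 h2 Set.inter_subset_right Set.inter_subset_right
  rwa [← Set.inter_union_distrib_left, Set.Iic_union_Ioi, Set.inter_univ] at this

/-- With `f` an east step of `Q`, these `Q(f) + 1` elements compete for the `Q(f)` indices below
`Q(f)`; once any one is removed, the rest fit. -/
theorem IsSeparated.isCircuit_insert_norths_Q (hD : D.IsSeparated) {f : ℕ} (h1 : 1 ≤ f)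
    (hn : f ≤ D.n) (hf : D.Q.yCoord f = D.Q.yCoord (f - 1)) :
    D.matroid.IsCircuit (insert f (D.Q.norths 0 (f - 1) : Set ℕ)) := by
  have hfN : f ∉ D.Q.norths 0 (f - 1) := by rw [LatticePath.mem_norths]; omega
  rw [Matroid.isCircuit_iff_dep_forall_sdiff_singleton_indep]
  refine ⟨⟨fun hI => ?_, ?_⟩, fun e he => ?_⟩
  · obtain ⟨φ, hφ, h⟩ := indep_iff D |>.1 hI
    have hcard := Finset.card_le_card_of_injOn (s := insert f (D.Q.norths 0 (f - 1)))
      (t := Finset.range (D.Q.yCoord f)) φ (fun x hx => by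
        rw [Finset.mem_coe, Finset.mem_insert] at hx
        rw [Finset.mem_coe, Finset.mem_range]
        have hxC : x ∈ insert f (D.Q.norths 0 (f - 1) : Set ℕ) := by simpa using hx
        refine (h x hxC).2.2.trans_le (D.Q.yCoord_le ?_)
        rcases hx with rfl | hx
        · exact le_rfl
        · rw [LatticePath.mem_norths] at hx; omega) (by simpa using hφ)
    have := LatticePath.card_norths_add (w := D.Q) (Nat.zero_le (f - 1))
    rw [Finset.card_insert_of_notMem hfN, Finset.card_range] at hcard
    simp only [LatticePath.yCoord_zero] at this
    omega
  · rw [ground_eq]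
    rintro x (rfl | hx)
    · exact ⟨h1, hn⟩
    · rw [Finset.mem_coe, LatticePath.mem_norths] at hx
      exact ⟨by omega, by omega⟩
  · rw [indep_iff]
    have hmem : ∀ x ∈ insert f (D.Q.norths 0 (f - 1) : Set ℕ) \ {e}, x ≠ e ∧ 1 ≤ x ∧ x ≤ f ∧
        (x = f ∨ D.Q.yCoord x = D.Q.yCoord (x - 1) + 1) := by
      rintro x ⟨rfl | hx, hxe⟩
      · exact ⟨hxe, h1, le_rfl, Or.inl rfl⟩
      · rw [Finset.mem_coe, LatticePath.mem_norths] at hx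
        exact ⟨hxe, by omega, by omega, Or.inr hx.2⟩
    have hef : e ≤ f ∧ 1 ≤ e ∧ (e < f → D.Q.yCoord e = D.Q.yCoord (e - 1) + 1) := by
      rcases he with rfl | he
      · exact ⟨le_rfl, h1, fun h => absurd h (lt_irrefl _)⟩
      · rw [Finset.mem_coe, LatticePath.mem_norths] at he
        exact ⟨by omega, by omega, fun _ => he.2⟩
    -- Elements before the removed `e` keep their index as north steps of `Q`; those after `e` move
    -- down by one. Separation leaves room for this above `P`.
    refine ⟨fun x => if x < e then D.Q.yCoord (x - 1) else D.Q.yCoord (x - 1) - 1, ?_, ?_⟩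
    · have aux : ∀ x ∈ insert f (D.Q.norths 0 (f - 1) : Set ℕ) \ {e},
          ∀ y ∈ insert f (D.Q.norths 0 (f - 1) : Set ℕ) \ {e}, x < y →
          (if x < e then D.Q.yCoord (x - 1) else D.Q.yCoord (x - 1) - 1) ≠
          (if y < e then D.Q.yCoord (y - 1) else D.Q.yCoord (y - 1) - 1) := by
        intro x hx y hy hxy
        have hx' := hmem x hx
        have hy' := hmem y hy
        have hxN : D.Q.yCoord x = D.Q.yCoord (x - 1) + 1 := by omega
        have h3 := D.Q.yCoord_le (show x ≤ y - 1 by omega)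
        split_ifs with h4 h5 h5
        · omega
        · have := D.Q.yCoord_le (show e ≤ y - 1 by omega)
          have := D.Q.yCoord_le (show x ≤ e - 1 by omega)
          omega
        · omega
        · have := D.Q.yCoord_le (show e ≤ x - 1 by omega)
          omega
      intro x hx y hy hxy
      by_contra hne
      rcases lt_or_gt_of_ne hne with h | h
      · exact aux x hx y hy h hxy
      · exact aux y hy x hx h hxy.symm
    · intro x hx
      have hx' := hmem x hx
      have hle := D.not_above (x - 1)
      refine ⟨hx'.2.1, ?_⟩
      dsimp only
      split_ifs with h4
      · omega
      · have := hD (x - 1) (by omega) (by omega)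
        have := D.Q.yCoord_le (show x - 1 ≤ x by omega)
        omega

/-- The mirror image: `f` and the later north steps of `P` compete for the indices from `P(f)` to `r
- 1`, and after removing `e` the north steps before `e` move up by one. -/
theorem IsSeparated.isCircuit_insert_norths_P (hD : D.IsSeparated) {f : ℕ} (h1 : 1 ≤ f)
    (hn : f ≤ D.n) (hf : D.P.yCoord f = D.P.yCoord (f - 1)) :
    D.matroid.IsCircuit (insert f (D.P.norths f D.n : Set ℕ)) := by
  have hfN : f ∉ D.P.norths f D.n := by rw [LatticePath.mem_norths]; omega
  rw [Matroid.isCircuit_iff_dep_forall_sdiff_singleton_indep]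
  refine ⟨⟨fun hI => ?_, ?_⟩, fun e he => ?_⟩
  · obtain ⟨φ, hφ, h⟩ := indep_iff D |>.1 hI
    have hcard := Finset.card_le_card_of_injOn (s := insert f (D.P.norths f D.n))
      (t := Finset.Ico (D.P.yCoord f) D.r) φ (fun x hx => by
        rw [Finset.mem_coe, Finset.mem_insert] at hx
        rw [Finset.mem_coe, Finset.mem_Ico]
        have hxC : x ∈ insert f (D.P.norths f D.n : Set ℕ) := by simpa using hx
        refine ⟨?_, (h x hxC).2.2.trans_le (D.yQ_le_r x)⟩
        rw [hf]
        refine le_trans (D.P.yCoord_le ?_) (h x hxC).2.1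
        rcases hx with rfl | hx
        · exact le_rfl
        · rw [LatticePath.mem_norths] at hx; omega) (by simpa using hφ)
    have := LatticePath.card_norths_add (w := D.P) hn
    rw [Finset.card_insert_of_notMem hfN, Nat.card_Ico] at hcard
    rw [D.yP_of_le le_rfl] at this
    omega
  · rw [ground_eq]
    rintro x (rfl | hx)
    · exact ⟨h1, hn⟩
    · rw [Finset.mem_coe, LatticePath.mem_norths] at hx
      exact ⟨by omega, by omega⟩
  · rw [indep_iff]
    have hmem : ∀ x ∈ insert f (D.P.norths f D.n : Set ℕ) \ {e}, x ≠ e ∧ f ≤ x ∧ x ≤ D.n ∧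
        (x = f ∨ D.P.yCoord x = D.P.yCoord (x - 1) + 1) := by
      rintro x ⟨rfl | hx, hxe⟩
      · exact ⟨hxe, le_rfl, hn, Or.inl rfl⟩
      · rw [Finset.mem_coe, LatticePath.mem_norths] at hx
        exact ⟨hxe, by omega, by omega, Or.inr hx.2⟩
    have hef : f ≤ e ∧ e ≤ D.n ∧ (f < e → D.P.yCoord e = D.P.yCoord (e - 1) + 1) := by
      rcases he with rfl | he
      · exact ⟨le_rfl, hn, fun h => absurd h (lt_irrefl _)⟩
      · rw [Finset.mem_coe, LatticePath.mem_norths] at he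
        exact ⟨by omega, by omega, fun _ => he.2⟩
    refine ⟨fun x => if x < e then D.P.yCoord x else D.P.yCoord (x - 1), ?_, ?_⟩
    · have aux : ∀ x ∈ insert f (D.P.norths f D.n : Set ℕ) \ {e},
          ∀ y ∈ insert f (D.P.norths f D.n : Set ℕ) \ {e}, x < y →
          (if x < e then D.P.yCoord x else D.P.yCoord (x - 1)) ≠
          (if y < e then D.P.yCoord y else D.P.yCoord (y - 1)) := by
        intro x hx y hy hxy
        have hx' := hmem x hx
        have hy' := hmem y hy
        have hyN : D.P.yCoord y = D.P.yCoord (y - 1) + 1 := by omega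
        have h3 := D.P.yCoord_le (show x ≤ y - 1 by omega)
        split_ifs with h4 h5 h5
        · omega
        · have := D.P.yCoord_le (show e ≤ y - 1 by omega)
          have := D.P.yCoord_le (show x ≤ e - 1 by omega)
          omega
        · omega
        · have := D.P.yCoord_le (show e ≤ x - 1 by omega)
          omega
      intro x hx y hy hxy
      by_contra hne
      rcases lt_or_gt_of_ne hne with h | h
      · exact aux x hx y hy h hxy
      · exact aux y hy x hx h hxy.symm
    · intro x hx
      have hx' := hmem x hx
      have hle := D.not_above x
      refine ⟨by omega, ?_⟩
      have := D.P.yCoord_le (show x - 1 ≤ x by omega)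
      dsimp only
      split_ifs with h4
      · have := hD x (by omega) (by omega)
        omega
      · omega

/-- This yields that `[a]` is closed. Elements of `[a]` use indices below `Q(a)`, and the north step
`a + 1` gives any `e > a` the free index `Q(e) - 1 ≥ Q(a)`. -/
theorem IsSeparated.mem_le_of_isCircuit_subset_insert (hD : D.IsSeparated) {a e : ℕ}
    (ha : D.Q.yCoord (a + 1) = D.Q.yCoord a + 1) {C : Set ℕ}
    (hC : D.matroid.IsCircuit C) (heC : e ∈ C) (hCe : C ⊆ insert e (Set.Iic a)) : e ≤ a := by
  by_contra! hea
  refine hC.not_indep ?_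
  obtain ⟨φ, hφ, h⟩ := (indep_iff D).1 (hC.sdiff_singleton_indep heC)
  have hea1 := D.Q.yCoord_le (show a + 1 ≤ e from hea)
  have hen : e ≤ D.n := (hC.subset_ground heC).2
  have hlow : ∀ x ∈ C \ {e}, φ x < D.Q.yCoord a := fun x hx =>
    (h x hx).2.2.trans_le (D.Q.yCoord_le ((hCe hx.1).resolve_left hx.2))
  refine (indep_iff D).2 ⟨fun x => if x = e then D.Q.yCoord e - 1 else φ x, ?_, fun x hx => ?_⟩
  · intro x hx y hy hxy
    by_cases hxe : x = e <;> by_cases hye : y = e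
    · rw [hxe, hye]
    · simp only [hxe, hye, if_true, if_false] at hxy
      have := hlow y ⟨hy, hye⟩
      omega
    · simp only [hxe, hye, if_true, if_false] at hxy
      have := hlow x ⟨hx, hxe⟩
      omega
    · simp only [hxe, hye, if_false] at hxy
      exact hφ ⟨hx, hxe⟩ ⟨hy, hye⟩ hxy
  · by_cases hxe : x = e
    · subst hxe
      simp only [if_true]
      refine ⟨by omega, ?_, by omega⟩
      rcases Nat.eq_zero_or_pos (x - 1) with h0 | h0
      · simp [h0]
      · have := hD (x - 1) h0 (by omega)
        have := D.Q.yCoord_le (show x - 1 ≤ x by omega)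
        omega
    · simpa only [hxe, if_false] using h x ⟨hx, hxe⟩

/-- This yields that `[b, n]` is closed: its elements use indices from `P(b-1)` on, while an `e < b`
can take `P(e-1)`, which is smaller because step `b - 1` of `P` is north. -/
theorem IsSeparated.le_mem_of_isCircuit_subset_insert (hD : D.IsSeparated) {b e : ℕ}
    (hb : D.P.yCoord (b - 1) = D.P.yCoord (b - 2) + 1) (hb2 : 2 ≤ b) (hbn : b ≤ D.n) {C : Set ℕ}
    (hC : D.matroid.IsCircuit C) (heC : e ∈ C) (hCe : C ⊆ insert e (Set.Ici b)) : b ≤ e := by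
  by_contra! heb
  refine hC.not_indep ?_
  obtain ⟨φ, hφ, h⟩ := (indep_iff D).1 (hC.sdiff_singleton_indep heC)
  have he1 : 1 ≤ e := (hC.subset_ground heC).1
  have heb1 := D.P.yCoord_le (show e - 1 ≤ b - 2 by omega)
  have hlow : ∀ x ∈ C \ {e}, D.P.yCoord (b - 1) ≤ φ x := fun x hx => by
    have : b ≤ x := (hCe hx.1).resolve_left hx.2
    exact (D.P.yCoord_le (by omega)).trans (h x hx).2.1
  refine (indep_iff D).2 ⟨fun x => if x = e then D.P.yCoord (e - 1) else φ x, ?_, fun x hx => ?_⟩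
  · intro x hx y hy hxy
    by_cases hxe : x = e <;> by_cases hye : y = e
    · rw [hxe, hye]
    · simp only [hxe, hye, if_true, if_false] at hxy
      have := hlow y ⟨hy, hye⟩
      omega
    · simp only [hxe, hye, if_true, if_false] at hxy
      have := hlow x ⟨hx, hxe⟩
      omega
    · simp only [hxe, hye, if_false] at hxy
      exact hφ ⟨hx, hxe⟩ ⟨hy, hye⟩ hxy
  · by_cases hxe : x = e
    · subst hxe
      simp only [if_true]
      refine ⟨by omega, le_rfl, ?_⟩
      have := hD x (by omega) (by omega)
      have := D.P.yCoord_le (show x - 1 ≤ x by omega)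
      omega
    · simpa only [hxe, if_false] using h x ⟨hx, hxe⟩

theorem indep_norths_Q (k : ℕ) : D.matroid.Indep (D.Q.norths 0 k : Set ℕ) := by
  refine (indep_iff D).2 ⟨fun x => D.Q.yCoord (x - 1), fun x hx y hy hxy => ?_, fun x hx => ?_⟩
  · rw [Finset.mem_coe, LatticePath.mem_norths] at hx hy
    by_contra hne
    have h1 (_ : x < y) := D.Q.yCoord_le (show x ≤ y - 1 by omega)
    have h2 (_ : y < x) := D.Q.yCoord_le (show y ≤ x - 1 by omega)
    simp only at hxy
    omega
  · rw [Finset.mem_coe, LatticePath.mem_norths] at hx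
    exact ⟨by omega, D.not_above _, by dsimp only; omega⟩

theorem indep_norths_P (k : ℕ) : D.matroid.Indep (D.P.norths k D.n : Set ℕ) := by
  refine (indep_iff D).2 ⟨fun x => D.P.yCoord (x - 1), fun x hx y hy hxy => ?_, fun x hx => ?_⟩
  · rw [Finset.mem_coe, LatticePath.mem_norths] at hx hy
    by_contra hne
    have h1 (_ : x < y) := D.P.yCoord_le (show x ≤ y - 1 by omega)
    have h2 (_ : y < x) := D.P.yCoord_le (show y ≤ x - 1 by omega)
    simp only at hxy
    omega
  · rw [Finset.mem_coe, LatticePath.mem_norths] at hx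
    have := D.not_above x
    exact ⟨by omega, le_rfl, by dsimp only; omega⟩

theorem encard_le_of_indep {I : Set ℕ} (hI : D.matroid.Indep I) : I.encard ≤ D.r := by
  obtain ⟨φ, hφ, h⟩ := (indep_iff D).1 hI
  rw [← hφ.encard_image]
  refine (Set.encard_le_encard (t := (Finset.range D.r : Set ℕ)) ?_).trans
    (by rw [Set.encard_coe_eq_coe_finsetCard, Finset.card_range])
  rintro _ ⟨x, hx, rfl⟩
  simpa using (h x hx).2.2.trans_le (D.yQ_le_r x)

end LatticePathPair

/-! ### Corners and mixed pairs in terms of heights -/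

namespace LatticePathPair

variable {D : LatticePathPair}

theorem IsENCorner.yQ_succ {a : ℕ} (h : D.IsENCorner a) :
    D.Q.yCoord (a + 1) = D.Q.yCoord a + 1 :=
  (LatticePath.step_eq_N_iff.1 h.2).2

theorem IsENCorner.yQ_eq {a : ℕ} (h : D.IsENCorner a) : D.Q.yCoord a = D.Q.yCoord (a - 1) :=
  (LatticePath.step_eq_E_iff.1 h.1).2.2

theorem IsENCorner.one_le {a : ℕ} (h : D.IsENCorner a) : 1 ≤ a :=
  (LatticePath.step_eq_E_iff.1 h.1).1

theorem IsENCorner.lt_n {a : ℕ} (h : D.IsENCorner a) : a < D.n := by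
  by_contra! hn
  have := D.yQ_of_le hn
  have := D.yQ_of_le (k := a + 1) (by omega)
  have := h.yQ_succ
  omega

theorem IsNECorner.yP_pred {b : ℕ} (h : D.IsNECorner b) :
    D.P.yCoord (b - 1) = D.P.yCoord (b - 2) + 1 :=
  (LatticePath.step_eq_N_iff.1 h.1).2

theorem IsNECorner.two_le {b : ℕ} (h : D.IsNECorner b) : 2 ≤ b := by
  have := (LatticePath.step_eq_N_iff.1 h.1).1
  omega

theorem IsNECorner.yP_eq {b : ℕ} (h : D.IsNECorner b) : D.P.yCoord b = D.P.yCoord (b - 1) :=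
  (LatticePath.step_eq_E_iff.1 h.2).2.2

theorem IsNECorner.le_n {b : ℕ} (h : D.IsNECorner b) : b ≤ D.n :=
  (LatticePath.step_eq_E_iff.1 h.2).2.1

/-- The first coordinate after `k` steps is `k` minus the height. The inequality is written
additively to avoid truncated subtraction. -/
theorem exists_isMixedPair_iff : (∃ A B, D.IsMixedPair A B) ↔ ∃ a b, D.IsENCorner a ∧
    D.IsNECorner b ∧ D.P.yCoord (b - 1) < D.Q.yCoord a ∧
    a + D.P.yCoord (b - 1) < b - 1 + D.Q.yCoord a := by
  have key : ∀ a b, D.IsENCorner a → D.IsNECorner b →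
      (D.Q.xCoord a < D.P.xCoord (b - 1) ↔
        a + D.P.yCoord (b - 1) < b - 1 + D.Q.yCoord a) := by
    intro a b ha hb
    have h1 := LatticePath.xCoord_add_yCoord (w := D.Q) (k := a) (by
      rw [D.length_Q]; exact ha.lt_n.le)
    have h2 := LatticePath.xCoord_add_yCoord (w := D.P) (k := b - 1)
      (by have := hb.le_n; change b - 1 ≤ D.n; omega)
    omega
  constructor
  · rintro ⟨A, B, a, b, ha, -, hb, -, h1, h2⟩
    exact ⟨a, b, ha, hb, h2, (key a b ha hb).1 h1⟩
  · rintro ⟨a, b, ha, hb, h1, h2⟩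
    exact ⟨_, _, a, b, ha, rfl, hb, rfl, (key a b ha hb).2 h2, h1⟩

end LatticePathPair

/-! ### Labellings, and why modularity excludes mixed pairs -/

namespace Matroid

variable {α : Type*} [LinearOrder α] {M : Matroid α} {D : LatticePathPair}

/-- The map `f` identifies `[n]`, the ground set of `M[P, Q]`, with the ground set of `M`, in an
order-preserving way. -/
structure IsLabelling (M : Matroid α) (D : LatticePathPair) (f : ℕ → α) : Prop where
  strictMonoOn : StrictMonoOn f (Set.Icc 1 D.n)
  image_eq : f '' Set.Icc 1 D.n = M.E
  indep_iff : ∀ I ⊆ Set.Icc 1 D.n, D.matroid.Indep I ↔ M.Indep (f '' I)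

theorem IsLatticePathMatroidOf.exists_isLabelling [Nonempty α] (h : M.IsLatticePathMatroidOf D) :
    ∃ f, M.IsLabelling D f := by
  classical
  obtain ⟨e, he⟩ := h
  let f : ℕ → α := fun k => if hk : k ∈ D.matroid.E then e ⟨k, hk⟩ else Classical.arbitrary α
  have hf : ∀ k (hk : k ∈ D.matroid.E), f k = e ⟨k, hk⟩ := fun k hk => dif_pos hk
  refine ⟨f, fun x hx y hy hxy => ?_, ?_, fun I hI => ?_⟩
  · rw [hf x hx, hf y hy]
    exact e.strictMono (a := ⟨x, hx⟩) (b := ⟨y, hy⟩) hxy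
  · ext z
    constructor
    · rintro ⟨k, hk, rfl⟩
      rw [hf k hk]
      exact (e _).2
    · intro hz
      refine ⟨e.symm ⟨z, hz⟩, (e.symm ⟨z, hz⟩).2, ?_⟩
      rw [hf _ (e.symm ⟨z, hz⟩).2]
      simp
  · have h1 := he (Subtype.val ⁻¹' I)
    rw [Subtype.image_preimage_coe, Set.inter_eq_right.2 (show I ⊆ D.matroid.E from hI)] at h1
    rw [h1]
    congr! 1
    ext z
    constructor
    · rintro ⟨_, ⟨k, hk, rfl⟩, rfl⟩
      exact ⟨k, hk, hf k k.2⟩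
    · rintro ⟨k, hk, rfl⟩
      exact ⟨_, ⟨⟨k, hI hk⟩, hk, rfl⟩, (hf k (hI hk)).symm⟩

theorem IsLabelling.isLatticePathMatroidOf {f : ℕ → α} (h : M.IsLabelling D f) :
    M.IsLatticePathMatroidOf D := by
  let e : D.matroid.E ≃o M.E :=
    (StrictMonoOn.orderIso f (Set.Icc 1 D.n) h.strictMonoOn).trans
      (OrderIso.setCongr _ _ h.image_eq)
  have he : ∀ k, (e k : α) = f k := fun k => rfl
  refine ⟨e, fun I => ?_⟩
  have hsub : (Subtype.val '' I : Set ℕ) ⊆ Set.Icc 1 D.n := by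
    rintro _ ⟨k, -, rfl⟩
    exact k.2
  rw [h.indep_iff _ hsub, Set.image_image, Set.image_image]
  simp only [he]

section Labelling

variable {f : ℕ → α}

theorem IsLabelling.finite (h : M.IsLabelling D f) : M.Finite :=
  ⟨h.image_eq ▸ (Set.finite_Icc 1 D.n).image f⟩

theorem IsLabelling.isCircuit_iff (h : M.IsLabelling D f) {C : Set ℕ} (hC : C ⊆ Set.Icc 1 D.n) :
    D.matroid.IsCircuit C ↔ M.IsCircuit (f '' C) := by
  rw [isCircuit_iff_dep_forall_sdiff_singleton_indep,
    isCircuit_iff_dep_forall_sdiff_singleton_indep, Set.forall_mem_image, Dep, Dep,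
    h.indep_iff C hC, ← h.image_eq]
  have h2 : f '' C ⊆ f '' Set.Icc 1 D.n := Set.image_mono hC
  have h3 : ∀ e ∈ C, f '' C \ {f e} = f '' (C \ {e}) := fun e he => by
    rw [(h.strictMonoOn.injOn.mono hC).image_sdiff_subset (Set.singleton_subset_iff.2 he),
      Set.image_singleton]
  simp only [show C ⊆ D.matroid.E from hC, h2, and_true]
  refine and_congr_right fun _ => forall₂_congr fun e he => ?_
  rw [h3 e he, h.indep_iff _ (Set.sdiff_subset.trans hC)]

theorem IsLabelling.exists_eq_image (h : M.IsLabelling D f) {X : Set α} (hX : X ⊆ M.E) :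
    ∃ I ⊆ Set.Icc 1 D.n, f '' I = X := by
  rw [← h.image_eq, Set.subset_image_iff] at hX
  exact hX

theorem IsLabelling.mem_image_iff (h : M.IsLabelling D f) {I : Set ℕ} (hI : I ⊆ Set.Icc 1 D.n)
    {k : ℕ} (hk : k ∈ Set.Icc 1 D.n) : f k ∈ f '' I ↔ k ∈ I :=
  h.strictMonoOn.injOn.mem_image_iff hI hk

theorem IsLabelling.le_of_isCircuit (h : M.IsLabelling D f) {C : Set α} (hC : M.IsCircuit C)
    {k x y : ℕ} (hk : D.P.yCoord k = D.Q.yCoord k) (hx : x ∈ Set.Icc 1 D.n)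
    (hy : y ∈ Set.Icc 1 D.n) (hxC : f x ∈ C) (hyC : f y ∈ C) (hxk : x ≤ k) : y ≤ k := by
  obtain ⟨C, hCs, rfl⟩ := h.exists_eq_image hC.subset_ground
  rw [h.mem_image_iff hCs hx] at hxC
  rw [h.mem_image_iff hCs hy] at hyC
  exact LatticePathPair.IsCircuit.not_cross hk ((h.isCircuit_iff hCs).2 hC) hxC hyC hxk

/-- Circuits do not cross a meeting point `k`, so an interior one would separate `k` from `k + 1`.
This covers every path pair representing the restriction, as needed for the existential in
`HasMixedPair`. -/
theorem IsConnectedComponent.isSeparated [M.Finitary] {X : Set α} (hX : M.IsConnectedComponent X)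
    (h : (M ↾ X).IsLabelling D f) : D.IsSeparated := by
  intro k hk0 hkn
  refine lt_of_le_of_ne (D.not_above k) fun hk => ?_
  have him : f '' Set.Icc 1 D.n = X := h.image_eq
  obtain ⟨x, hxE, hXx⟩ := id hX
  have hxX : x ∈ X := by rw [hXx]; exact ⟨hxE, Or.inl rfl⟩
  rw [← him] at hxX
  obtain ⟨j, hj, rfl⟩ := hxX
  have key : ∀ y ∈ Set.Icc 1 D.n, j ≠ y → (j ≤ k ↔ y ≤ k) := by
    intro y hy hjy
    have hyX : f y ∈ X := him ▸ Set.mem_image_of_mem f hy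
    have hjX : f j ∈ X := him ▸ Set.mem_image_of_mem f hj
    have hy' := hyX
    rw [hXx] at hy'
    rcases hy'.2 with heq | ⟨C, hC, hjC, hyC⟩
    · exact absurd (h.strictMonoOn.injOn hj hy heq) hjy
    · have hC' : (M ↾ X).IsCircuit C :=
        hC.isCircuit_restrict_of_subset (hX.subset_of_isCircuit hC hjC hjX)
      exact ⟨h.le_of_isCircuit hC' hk hj hy hjC hyC, h.le_of_isCircuit hC' hk hy hj hyC hjC⟩
  rcases le_or_gt j k with hjk | hjk
  · have := (key (k + 1) ⟨by omega, by omega⟩ (by omega)).1 hjk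
    omega
  · have := (key k ⟨by omega, by omega⟩ (by omega)).2 le_rfl
    omega

/-- Each east step of `Q` up to `a` lies in its own circuit, and all the north steps lie in the
circuit of the east step `a`. -/
theorem IsLabelling.isCyclic_image_Icc_Q (h : M.IsLabelling D f) (hD : D.IsSeparated) {a : ℕ}
    (ha : D.IsENCorner a) : M.IsCyclic (f '' Set.Icc 1 a) := by
  have hcirc : ∀ g, 1 ≤ g → g ≤ a → D.Q.yCoord g = D.Q.yCoord (g - 1) →
      M.IsCircuit (f '' insert g (D.Q.norths 0 (g - 1) : Set ℕ)) := by
    intro g h1 hga hg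
    have := hD.isCircuit_insert_norths_Q h1 (hga.trans ha.lt_n.le) hg
    exact (h.isCircuit_iff this.subset_ground).1 this
  refine ⟨{C | M.IsCircuit C ∧ C ⊆ f '' Set.Icc 1 a}, fun C hC => hC.1,
    subset_antisymm ?_ (Set.sUnion_subset fun C hC => hC.2)⟩
  rintro _ ⟨x, hx, rfl⟩
  have hsub : ∀ g, 1 ≤ g → g ≤ a →
      insert g (D.Q.norths 0 (g - 1) : Set ℕ) ⊆ Set.Icc 1 a := by
    rintro g h1 hga y (rfl | hy)
    · exact ⟨h1, hga⟩
    · rw [Finset.mem_coe, LatticePath.mem_norths] at hy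
      exact ⟨by omega, by omega⟩
  by_cases hxE : D.Q.yCoord x = D.Q.yCoord (x - 1)
  · exact ⟨_, ⟨hcirc x hx.1 hx.2 hxE, Set.image_mono (hsub x hx.1 hx.2)⟩,
      Set.mem_image_of_mem f (Set.mem_insert _ _)⟩
  · refine ⟨_, ⟨hcirc a ha.one_le le_rfl ha.yQ_eq, Set.image_mono (hsub a ha.one_le le_rfl)⟩,
      Set.mem_image_of_mem f (Or.inr ?_)⟩
    rw [Finset.mem_coe, LatticePath.mem_norths]
    have hxa : x ≠ a := by rintro rfl; exact hxE ha.yQ_eq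
    have h1 := hx.1
    have h2 := hx.2
    have h3 := D.Q.yCoord_succ_le (x - 1)
    have h4 := D.Q.yCoord_le_succ (x - 1)
    rw [Nat.sub_add_cancel h1] at h3 h4
    omega

theorem IsLabelling.isCyclic_image_Icc_P (h : M.IsLabelling D f) (hD : D.IsSeparated) {b : ℕ}
    (hb : D.IsNECorner b) : M.IsCyclic (f '' Set.Icc b D.n) := by
  have hb1 : 1 ≤ b := by have := hb.two_le; omega
  have hcirc : ∀ g, b ≤ g → g ≤ D.n → D.P.yCoord g = D.P.yCoord (g - 1) →
      M.IsCircuit (f '' insert g (D.P.norths g D.n : Set ℕ)) := by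
    intro g h1 hga hg
    have := hD.isCircuit_insert_norths_P (hb1.trans h1) hga hg
    exact (h.isCircuit_iff this.subset_ground).1 this
  refine ⟨{C | M.IsCircuit C ∧ C ⊆ f '' Set.Icc b D.n}, fun C hC => hC.1,
    subset_antisymm ?_ (Set.sUnion_subset fun C hC => hC.2)⟩
  rintro _ ⟨x, hx, rfl⟩
  have hsub : ∀ g, b ≤ g → g ≤ D.n →
      insert g (D.P.norths g D.n : Set ℕ) ⊆ Set.Icc b D.n := by
    rintro g h1 hga y (rfl | hy)
    · exact ⟨h1, hga⟩
    · rw [Finset.mem_coe, LatticePath.mem_norths] at hy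
      exact ⟨by omega, by omega⟩
  by_cases hxE : D.P.yCoord x = D.P.yCoord (x - 1)
  · exact ⟨_, ⟨hcirc x hx.1 hx.2 hxE, Set.image_mono (hsub x hx.1 hx.2)⟩,
      Set.mem_image_of_mem f (Set.mem_insert _ _)⟩
  · refine ⟨_, ⟨hcirc b le_rfl hb.le_n hb.yP_eq, Set.image_mono (hsub b le_rfl hb.le_n)⟩,
      Set.mem_image_of_mem f (Or.inr ?_)⟩
    rw [Finset.mem_coe, LatticePath.mem_norths]
    have hxa : x ≠ b := by rintro rfl; exact hxE hb.yP_eq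
    have h1 := hx.1
    have h2 := hx.2
    have h3 := D.P.yCoord_succ_le (x - 1)
    have h4 := D.P.yCoord_le_succ (x - 1)
    rw [Nat.sub_add_cancel (hb1.trans h1)] at h3 h4
    omega

theorem IsLabelling.closure_image_Icc_subset_Q (h : M.IsLabelling D f) (hD : D.IsSeparated) {a : ℕ}
    (ha : D.IsENCorner a) : M.closure (f '' Set.Icc 1 a) ⊆ f '' Set.Icc 1 a := by
  intro z hz
  by_contra hzA
  obtain ⟨C, hCs, hC, hzC⟩ := exists_isCircuit_of_mem_closure hz hzA
  obtain ⟨C, hCn, rfl⟩ := h.exists_eq_image hC.subset_ground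
  obtain ⟨e, heC, rfl⟩ := hzC
  have := hD.mem_le_of_isCircuit_subset_insert ha.yQ_succ ((h.isCircuit_iff hCn).2 hC) heC
    fun y hy => by
      rcases hCs (Set.mem_image_of_mem f hy) with heq | hmem
      · exact Or.inl (h.strictMonoOn.injOn (hCn hy) (hCn heC) heq)
      · rw [h.mem_image_iff (Set.Icc_subset_Icc_right ha.lt_n.le) (hCn hy)] at hmem
        exact Or.inr hmem.2
  exact hzA ⟨e, ⟨(hCn heC).1, this⟩, rfl⟩

theorem IsLabelling.closure_image_Icc_subset_P (h : M.IsLabelling D f) (hD : D.IsSeparated) {b : ℕ}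
    (hb : D.IsNECorner b) : M.closure (f '' Set.Icc b D.n) ⊆ f '' Set.Icc b D.n := by
  have hb1 : 1 ≤ b := by have := hb.two_le; omega
  intro z hz
  by_contra hzA
  obtain ⟨C, hCs, hC, hzC⟩ := exists_isCircuit_of_mem_closure hz hzA
  obtain ⟨C, hCn, rfl⟩ := h.exists_eq_image hC.subset_ground
  obtain ⟨e, heC, rfl⟩ := hzC
  have := hD.le_mem_of_isCircuit_subset_insert hb.yP_pred hb.two_le hb.le_n
    ((h.isCircuit_iff hCn).2 hC) heC
    fun y hy => by
      rcases hCs (Set.mem_image_of_mem f hy) with heq | hmem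
      · exact Or.inl (h.strictMonoOn.injOn (hCn hy) (hCn heC) heq)
      · rw [h.mem_image_iff (Set.Icc_subset_Icc_left hb1) (hCn hy)] at hmem
        exact Or.inr hmem.1
  exact hzA ⟨e, ⟨this, (hCn heC).2⟩, rfl⟩

/-- Modularity of the closures of `A` and `B` would give `Q(a) + (r - P(b-1)) ≤ r + |[b, a]|`,
contrary to the two mixed inequalities. -/
theorem IsConnectedComponent.not_hasMixedPair [M.Finitary] {X : Set α}
    (hX : M.IsConnectedComponent X)
    (hM : ∀ X Y : Set α, M.IsCyclicFlat X → M.IsCyclicFlat Y → M.IsModularPair X Y) :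
    ¬ (M ↾ X).HasMixedPair := by
  rintro ⟨D, hD, hmix⟩
  obtain ⟨a, b, ha, hb, h1, h2⟩ := LatticePathPair.exists_isMixedPair_iff.1 hmix
  have : Nonempty α := let ⟨x, _⟩ := hX; ⟨x⟩
  obtain ⟨f, hf⟩ := hD.exists_isLabelling
  have hsep := hX.isSeparated hf
  have him : f '' Set.Icc 1 D.n = X := hf.image_eq
  have hXE := hX.subset_ground
  have hb1 : 1 ≤ b := by have := hb.two_le; omega
  set A := f '' Set.Icc 1 a with hA
  set B := f '' Set.Icc b D.n with hB
  have hAX : A ⊆ X := him ▸ Set.image_mono (Set.Icc_subset_Icc_right ha.lt_n.le)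
  have hBX : B ⊆ X := him ▸ Set.image_mono (Set.Icc_subset_Icc_left hb1)
  have hAc : M.IsCyclic A := (hf.isCyclic_image_Icc_Q hsep ha).of_restrict hXE
  have hBc : M.IsCyclic B := (hf.isCyclic_image_Icc_P hsep hb).of_restrict hXE
  have hmod := hM _ _ hAc.isCyclicFlat_closure hBc.isCyclicFlat_closure
  have hAcl := hX.closure_subset hAX (hf.closure_image_Icc_subset_Q hsep ha)
  have hBcl := hX.closure_subset hBX (hf.closure_image_Icc_subset_P hsep hb)
  have hrank : ∀ I ⊆ Set.Icc 1 D.n, D.matroid.Indep I → M.Indep (f '' I) := fun I hI hi =>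
    ((hf.indep_iff I hI).1 hi).of_restrict
  have hencard : ∀ I ⊆ Set.Icc 1 D.n, (f '' I).encard = I.encard := fun I hI =>
    (hf.strictMonoOn.injOn.mono hI).encard_image
  have hrA : (D.Q.yCoord a : ℕ∞) ≤ M.eRk A := by
    have hsub : (D.Q.norths 0 a : Set ℕ) ⊆ Set.Icc 1 a := fun x hx => by
      rw [Finset.mem_coe, LatticePath.mem_norths] at hx
      exact ⟨by omega, by omega⟩
    have hsub' := hsub.trans (Set.Icc_subset_Icc_right ha.lt_n.le)
    have := (hrank _ hsub' (D.indep_norths_Q a)).encard_le_eRk_of_subset (Set.image_mono hsub)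
    rw [hencard _ hsub', Set.encard_coe_eq_coe_finsetCard] at this
    have hc := LatticePath.card_norths_add (w := D.Q) (Nat.zero_le a)
    rw [LatticePath.yCoord_zero, add_zero] at hc
    rwa [hc] at this
  have hrB : ((D.r - D.P.yCoord (b - 1) : ℕ) : ℕ∞) ≤ M.eRk B := by
    have hsub : (D.P.norths b D.n : Set ℕ) ⊆ Set.Icc b D.n := fun x hx => by
      rw [Finset.mem_coe, LatticePath.mem_norths] at hx
      exact ⟨by omega, by omega⟩
    have hsub' := hsub.trans (Set.Icc_subset_Icc_left hb1)
    have := (hrank _ hsub' (D.indep_norths_P b)).encard_le_eRk_of_subset (Set.image_mono hsub)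
    rw [hencard _ hsub', Set.encard_coe_eq_coe_finsetCard] at this
    have hc := LatticePath.card_norths_add (w := D.P) hb.le_n
    have h3 := hb.yP_eq
    rw [D.yP_of_le le_rfl] at hc
    rwa [show D.r - D.P.yCoord (b - 1) = (D.P.norths b D.n).card by omega]
  have hrX : M.eRk (M.closure A ∪ M.closure B) ≤ D.r := by
    refine (M.eRk_mono (Set.union_subset (M.closure_subset_closure hAX)
      (M.closure_subset_closure hBX))).trans ?_
    rw [eRk_closure_eq, eRk_le_iff]
    intro I hIX hI
    obtain ⟨J, hJ, rfl⟩ := hf.exists_eq_image hIX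
    rw [hencard J hJ]
    exact D.encard_le_of_indep ((hf.indep_iff J hJ).2 (restrict_indep_iff.2 ⟨hI, hIX⟩))
  -- Loops have rank zero, so only `A ∩ B` counts. The truncated difference also covers disjoint `A`
  -- and `B`; the inequality `a₂ > b₂` disposes of that case, `a₁ < b₁` of the other.
  have hrI : M.eRk (M.closure A ∩ M.closure B) ≤ ((a + 1 - b : ℕ) : ℕ∞) := by
    have hsub : M.closure A ∩ M.closure B ⊆ (A ∩ B) ∪ M.loops := by
      rintro x ⟨hxA, hxB⟩
      rcases hAcl hxA with h | h
      · rcases hBcl hxB with h' | h'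
        · exact Or.inl ⟨h, h'⟩
        · exact Or.inr h'
      · exact Or.inr h
    refine (M.eRk_mono hsub).trans ?_
    rw [eRk_eq_eRk_union_eRk_le_zero _ M.eRk_loops.le, hA, hB,
      ← (hf.strictMonoOn.injOn).image_inter (Set.Icc_subset_Icc_right ha.lt_n.le)
        (Set.Icc_subset_Icc_left hb1)]
    refine (M.eRk_le_encard _).trans ((Set.encard_image_le _ _).trans ?_)
    rw [Set.Icc_inter_Icc, ← Finset.coe_Icc, Set.encard_coe_eq_coe_finsetCard, Nat.card_Icc]
    refine Nat.cast_le.2 ?_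
    have := le_max_right 1 b
    have := min_le_left a D.n
    omega
  unfold IsModularPair at hmod
  rw [eRk_closure_eq, eRk_closure_eq] at hmod
  have hfinal : ((D.Q.yCoord a + (D.r - D.P.yCoord (b - 1)) : ℕ) : ℕ∞) ≤
      ((D.r + (a + 1 - b) : ℕ) : ℕ∞) := by
    push_cast [Nat.cast_add]
    exact ((add_le_add hrA hrB).trans hmod.le).trans (add_le_add hrX hrI)
  have := Nat.cast_le.1 hfinal
  have := D.yP_le_r (b - 1)
  omega

end Labelling

end Matroid

/-! ### Counting functions, the corner path and its fundamental presentation -/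

theorem IsPartialTransversal.exists_superset {α ι : Type*} {A : ι → Set α} {I J : Set α}
    (hIfin : I.Finite) (hI : IsPartialTransversal A I)
    (hJ : IsPartialTransversal A J) (hle : I.ncard ≤ J.ncard) :
    ∃ S, I ⊆ S ∧ S ⊆ I ∪ J ∧ S.ncard = J.ncard ∧ IsPartialTransversal A S := by
  obtain ⟨d, hd⟩ := Nat.exists_eq_add_of_le hle
  induction d generalizing I with
  | zero => exact ⟨I, subset_rfl, Set.subset_union_left, by omega, hI⟩
  | succ d ih =>
    obtain ⟨e, heJ, heI, he⟩ := hI.augment hIfin hJ (by omega)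
    have hc := Set.ncard_insert_of_notMem heI hIfin
    obtain ⟨S, h1, h2, h3, h4⟩ := ih (hIfin.insert e) he (by omega) (by omega)
    refine ⟨S, (Set.subset_insert _ _).trans h1, h2.trans ?_, h3, h4⟩
    rw [Set.insert_union]
    exact Set.insert_subset (Or.inr heJ) subset_rfl

/-- The number of elements of `S` that are at most `k`. -/
def countLE (S : Finset ℕ) (k : ℕ) : ℕ := (S.filter (· ≤ k)).card

theorem countLE_succ (S : Finset ℕ) (k : ℕ) :
    countLE S (k + 1) = countLE S k + if k + 1 ∈ S then 1 else 0 := by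
  unfold countLE
  have : (S.filter (· ≤ k + 1)) =
      if k + 1 ∈ S then insert (k + 1) (S.filter (· ≤ k)) else S.filter (· ≤ k) := by
    ext x
    split_ifs with h
    · simp only [Finset.mem_filter, Finset.mem_insert]
      constructor
      · rintro ⟨h1, h2⟩
        by_cases hx : x = k + 1
        · exact Or.inl hx
        · exact Or.inr ⟨h1, by omega⟩
      · rintro (rfl | ⟨h1, h2⟩)
        · exact ⟨h, le_rfl⟩
        · exact ⟨h1, by omega⟩
    · simp only [Finset.mem_filter]
      refine and_congr_right fun hx => ⟨fun h1 => ?_, fun h1 => by omega⟩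
      have : x ≠ k + 1 := by rintro rfl; exact h hx
      omega
  rw [this]
  split_ifs with h
  · rw [Finset.card_insert_of_notMem (by simp)]
  · rfl

theorem countLE_mono (S : Finset ℕ) {j k : ℕ} (h : j ≤ k) : countLE S j ≤ countLE S k :=
  Finset.card_le_card fun x hx => by
    rw [Finset.mem_filter] at hx ⊢
    exact ⟨hx.1, hx.2.trans h⟩

theorem countLE_lt_of_mem {S : Finset ℕ} {x k : ℕ} (hx : x ∈ S) (h : k < x) :
    countLE S k < countLE S x := by
  obtain ⟨x, rfl⟩ := Nat.exists_eq_add_of_le' (Nat.one_le_of_lt h)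
  rw [countLE_succ, if_pos hx]
  have := countLE_mono S (show k ≤ x by omega)
  omega

theorem countLE_le_card (S : Finset ℕ) (k : ℕ) : countLE S k ≤ S.card :=
  Finset.card_filter_le _ _

theorem countLE_eq_card {S : Finset ℕ} {k : ℕ} (h : ∀ x ∈ S, x ≤ k) : countLE S k = S.card := by
  rw [countLE, Finset.filter_true_of_mem h]

theorem countLE_zero {S : Finset ℕ} (h : ∀ x ∈ S, 1 ≤ x) : countLE S 0 = 0 := by
  rw [countLE, Finset.filter_false_of_mem fun x hx => by have := h x hx; omega, Finset.card_empty]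

/-- Both sides count the elements of `S ∪ T` up to `k`. It serves to compare a basis with the north
steps of the corner path. -/
theorem countLE_add_countLE_sdiff (S T : Finset ℕ) (k : ℕ) :
    countLE S k + countLE (T \ S) k = countLE T k + countLE (S \ T) k := by
  have h (U V : Finset ℕ) : countLE U k + countLE (V \ U) k = ((U ∪ V).filter (· ≤ k)).card := by
    unfold countLE
    rw [← Finset.card_union_of_disjoint, ← Finset.filter_union, Finset.union_sdiff_self_eq_union]
    exact Finset.disjoint_filter_filter Finset.disjoint_sdiff
  rw [h, h, Finset.union_comm]

theorem exists_mem_countLE_eq {S : Finset ℕ} (h1 : ∀ x ∈ S, 1 ≤ x) {c : ℕ} (hc : 1 ≤ c)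
    (hcS : c ≤ S.card) : ∃ x ∈ S, countLE S x = c ∧ ∀ k < x, countLE S k < c := by
  classical
  have hex : ∃ k, c ≤ countLE S k := by
    refine ⟨S.sup id, ?_⟩
    rwa [countLE_eq_card fun x hx => Finset.le_sup (f := id) hx]
  have hmin : ∀ k < Nat.find hex, countLE S k < c := fun k hk => not_le.1 (Nat.find_min hex hk)
  have hspec := Nat.find_spec hex
  obtain ⟨m, hm⟩ : ∃ m, Nat.find hex = m + 1 := by
    refine Nat.exists_eq_succ_of_ne_zero fun h0 => ?_
    rw [h0, countLE_zero h1] at hspec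
    omega
  have := hmin m (by omega)
  rw [hm, countLE_succ] at hspec
  split_ifs at hspec with hmem
  · refine ⟨m + 1, hmem, ?_, hm ▸ hmin⟩
    rw [countLE_succ, if_pos hmem]
    omega
  · omega

namespace LatticePath

theorem yCoord_le_add_sub (w : LatticePath) (j k : ℕ) : w.yCoord j ≤ w.yCoord k + (j - k) := by
  rcases le_total j k with h | h
  · have := w.yCoord_le h
    omega
  · obtain ⟨d, rfl⟩ := Nat.exists_eq_add_of_le h
    induction d with
    | zero => simp
    | succ d ih =>
      have := ih (by omega)
      have := w.yCoord_succ_le (k + d)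
      rw [← add_assoc]
      omega

end LatticePath

namespace LatticePathPair

variable {D : LatticePathPair}

/-- Each element takes as index its rank within `S`, counted from 0. With the two bounds
`countLE_le_of_indep` and `le_countLE_of_indep`, bases are the north-step sets of paths between `P`
and `Q`. -/
theorem indep_of_countLE {S : Finset ℕ} (hS : ∀ x ∈ S, 1 ≤ x)
    (hP : ∀ k, D.P.yCoord k ≤ countLE S k) (hQ : ∀ k, countLE S k ≤ D.Q.yCoord k) :
    D.matroid.Indep (S : Set ℕ) := by
  refine (indep_iff D).2 ⟨fun x => countLE S x - 1, fun x hx y hy hxy => ?_, fun x hx => ?_⟩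
  · by_contra hne
    have hx0 := countLE_lt_of_mem hx (hS x hx)
    have hy0 := countLE_lt_of_mem hy (hS y hy)
    simp only at hxy
    rcases lt_or_gt_of_ne hne with h | h
    · have := countLE_lt_of_mem hy h
      omega
    · have := countLE_lt_of_mem hx h
      omega
  · have h1 := hS x hx
    have := countLE_lt_of_mem hx (show x - 1 < x by omega)
    have := hP (x - 1)
    have := hQ x
    exact ⟨h1, by dsimp only; omega, by dsimp only; omega⟩

theorem countLE_le_of_indep {S : Finset ℕ} (hS : D.matroid.Indep (S : Set ℕ)) (k : ℕ) :
    countLE S k ≤ D.Q.yCoord k := by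
  obtain ⟨φ, hφ, h⟩ := (indep_iff D).1 hS
  have := Finset.card_le_card_of_injOn (s := S.filter (· ≤ k)) (t := Finset.range (D.Q.yCoord k)) φ
    (fun x hx => by
      rw [Finset.mem_coe, Finset.mem_filter] at hx
      rw [Finset.mem_coe, Finset.mem_range]
      exact (h x hx.1).2.2.trans_le (D.Q.yCoord_le hx.2))
    (hφ.mono fun x hx => Finset.filter_subset _ _ hx)
  rwa [Finset.card_range] at this

theorem card_le_countLE_add {S : Finset ℕ} {k y r : ℕ} {φ : ℕ → ℕ} (hφ : Set.InjOn φ (S : Set ℕ))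
    (h : ∀ x ∈ S, k < x → y ≤ φ x) (hr : ∀ x ∈ S, φ x < r) :
    S.card ≤ countLE S k + (r - y) := by
  rw [countLE, ← Finset.card_filter_add_card_filter_not (s := S) (· ≤ k)]
  refine Nat.add_le_add_left ?_ _
  rw [← Nat.card_Ico]
  refine Finset.card_le_card_of_injOn φ (fun x hx => ?_)
    (hφ.mono fun x hx => Finset.filter_subset _ _ hx)
  rw [Finset.mem_coe, Finset.mem_filter, not_le] at hx
  rw [Finset.mem_coe, Finset.mem_Ico]
  exact ⟨h x hx.1 hx.2, hr x hx.1⟩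

/-- Elements after `k` use indices at or above `P(k)`, so there are at most `r - P(k)` of them; the
rest of the `r` elements are at most `k`. -/
theorem le_countLE_of_indep {S : Finset ℕ} (hS : D.matroid.Indep (S : Set ℕ))
    (hcard : S.card = D.r) (k : ℕ) : D.P.yCoord k ≤ countLE S k := by
  obtain ⟨φ, hφ, h⟩ := (indep_iff D).1 hS
  have := card_le_countLE_add (k := k) (y := D.P.yCoord k) (r := D.r) hφ
    (fun x hx hkx => (D.P.yCoord_le (by omega)).trans (h x hx).2.1)
    (fun x hx => (h x hx).2.2.trans_le (D.yQ_le_r x))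
  have := D.yP_le_r k
  omega

/-- A set of at most `r` elements that satisfies the upper path condition at the `EN` corners of `Q`
satisfies it everywhere. -/
theorem countLE_le_of_isENCorner {S : Finset ℕ} (hS : ∀ x ∈ S, 1 ≤ x) (hcard : S.card ≤ D.r)
    (h : ∀ a, D.IsENCorner a → countLE S a ≤ D.Q.yCoord a) (k : ℕ) :
    countLE S k ≤ D.Q.yCoord k := by
  induction k with
  | zero => rw [countLE_zero hS]; omega
  | succ k ih =>
    by_contra! hlt
    have h1 := countLE_succ S k
    have h2 := D.Q.yCoord_le_succ k
    have hQk : D.Q.yCoord (k + 1) = D.Q.yCoord k := by split_ifs at h1 <;> omega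
    -- A first violation happens at an east step of `Q` and persists until `Q` turns north, which is
    -- an `EN` corner. If `Q` never does, its height there is `r`, too large to be exceeded.
    have hforward : ∀ j, D.Q.yCoord (k + 1 + j) = D.Q.yCoord (k + 1) ∧
        D.Q.yCoord (k + 1 + j) = D.Q.yCoord (k + j) := by
      intro j
      induction j with
      | zero => exact ⟨rfl, hQk⟩
      | succ j ihj =>
        suffices hs : D.Q.yCoord (k + 1 + (j + 1)) = D.Q.yCoord (k + 1 + j) by
          refine ⟨hs.trans ihj.1, hs.trans ?_⟩
          congr 1; omega
        by_contra hne
        have h3 := D.Q.yCoord_le_succ (k + 1 + j)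
        have h4 := D.Q.yCoord_succ_le (k + 1 + j)
        rw [← add_assoc] at hne
        have hN : D.Q.step (k + 1 + j + 1) = some LatticeStep.N :=
          LatticePath.step_eq_N_iff.2 ⟨by omega, by rw [Nat.add_sub_cancel]; omega⟩
        have hlen : k + 1 + j ≤ D.Q.length := by
          by_contra! hcon
          rw [LatticePath.step_eq_none (by omega)] at hN
          simp at hN
        have hE : D.Q.step (k + 1 + j) = some LatticeStep.E :=
          LatticePath.step_eq_E_iff.2 ⟨by omega, hlen, by
            rw [ihj.2]; congr 1; omega⟩
        have := h _ ⟨hE, hN⟩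
        have := countLE_mono S (show k + 1 ≤ k + 1 + j by omega)
        omega
    have h5 := (hforward D.n).1
    rw [D.yQ_of_le (by omega)] at h5
    have := countLE_le_card S (k + 1)
    omega

/-- A set of `r` elements that satisfies the lower path condition at the `NE` corners of `P`
satisfies it everywhere. -/
theorem le_countLE_of_isNECorner {S : Finset ℕ} (hSn : ∀ x ∈ S, x ≤ D.n)
    (hcard : S.card = D.r)
    (h : ∀ b, D.IsNECorner b → D.P.yCoord (b - 1) ≤ countLE S (b - 1)) (k : ℕ) :
    D.P.yCoord k ≤ countLE S k := by
  induction k with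
  | zero => simp
  | succ k ih =>
    by_contra! hlt
    have h1 := countLE_succ S k
    have h2 := D.P.yCoord_succ_le k
    have hPk : D.P.yCoord (k + 1) = D.P.yCoord k + 1 := by split_ifs at h1 <;> omega
    have hkn : k + 1 ≤ D.n := by
      by_contra! hcon
      have := D.yP_of_le (k := k) (by omega)
      have := D.yP_of_le (k := k + 1) (by omega)
      omega
    -- A first violation happens at a north step of `P` and persists until `P` turns east, which is
    -- an `NE` corner. Otherwise it reaches `n`, where both counts equal `r`.
    have hforward : ∀ j, k + 1 + j ≤ D.n → countLE S (k + 1 + j) < D.P.yCoord (k + 1 + j) ∧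
        D.P.yCoord (k + 1 + j) = D.P.yCoord (k + j) + 1 := by
      intro j
      induction j with
      | zero => exact fun _ => ⟨hlt, hPk⟩
      | succ j ihj =>
        intro hj
        obtain ⟨ih1, ih2⟩ := ihj (by omega)
        suffices hs : D.P.yCoord (k + 1 + (j + 1)) = D.P.yCoord (k + 1 + j) + 1 by
          refine ⟨?_, hs.trans ?_⟩
          · have := countLE_succ S (k + 1 + j)
            rw [hs, ← add_assoc]
            split_ifs at this <;> omega
          · congr 2; omega
        by_contra hne
        have h3 := D.P.yCoord_le_succ (k + 1 + j)
        have h4 := D.P.yCoord_succ_le (k + 1 + j)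
        rw [← add_assoc] at hne
        have hE : D.P.step (k + 1 + j + 1) = some LatticeStep.E :=
          LatticePath.step_eq_E_iff.2
            ⟨by omega, by change _ ≤ D.n; omega, by rw [Nat.add_sub_cancel]; omega⟩
        have hN : D.P.step (k + 1 + j) = some LatticeStep.N :=
          LatticePath.step_eq_N_iff.2 ⟨by omega, by
            rw [ih2]; congr 2; omega⟩
        have := h (k + 1 + j + 1) ⟨hN, hE⟩
        rw [Nat.add_sub_cancel] at this
        omega
    have h5 := (hforward (D.n - (k + 1)) (by omega)).1
    rw [D.yP_of_le (by omega), countLE_eq_card fun x hx => by have := hSn x hx; omega] at h5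
    omega

/-- A height function of a lattice path between `P` and `Q` that passes through all `EN` corners
of `Q` and all `NE` corners of `P`. -/
structure IsCornerPath (D : LatticePathPair) (R : ℕ → ℕ) : Prop where
  le_succ : ∀ k, R k ≤ R (k + 1)
  succ_le : ∀ k, R (k + 1) ≤ R k + 1
  le_Q : ∀ k, R k ≤ D.Q.yCoord k
  P_le : ∀ k, D.P.yCoord k ≤ R k
  eq_Q : ∀ a, D.IsENCorner a → R a = D.Q.yCoord a
  eq_P : ∀ b, D.IsNECorner b → R (b - 1) = D.P.yCoord (b - 1)

theorem exists_isCornerPath (h : ¬ ∃ A B, D.IsMixedPair A B) : ∃ R, D.IsCornerPath R := by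
  classical
  rw [exists_isMixedPair_iff] at h
  push Not at h
  let s := (Finset.range D.n).filter D.IsENCorner
  have hs : ∀ {a}, a ∈ s ↔ D.IsENCorner a := fun {a} => by
    simp only [s, Finset.mem_filter, Finset.mem_range, and_iff_right_iff_imp]
    exact fun ha => ha.lt_n
  -- For each `EN` corner `a`, the term is the height of the path that climbs by north steps into
  -- the corner and is flat afterwards, since `a - k = 0` for `k ≥ a`. The maximum of `P` and `g` is
  -- the lowest candidate through these corners.
  let g : ℕ → ℕ := fun k => s.sup fun a => D.Q.yCoord a - (a - k)
  have hg : ∀ {k a}, D.IsENCorner a → D.Q.yCoord a - (a - k) ≤ g k := fun {k a} ha =>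
    Finset.le_sup (f := fun a => D.Q.yCoord a - (a - k)) (hs.2 ha)
  have hgle : ∀ {k c}, (∀ a, D.IsENCorner a → D.Q.yCoord a - (a - k) ≤ c) → g k ≤ c :=
    fun h => Finset.sup_le fun a ha => h a (hs.1 ha)
  have hgQ : ∀ k, g k ≤ D.Q.yCoord k := fun k => hgle fun a _ => by
    have := D.Q.yCoord_le_add_sub a k
    omega
  refine ⟨fun k => max (D.P.yCoord k) (g k), fun k => max_le_max (D.P.yCoord_le_succ k) ?_,
    fun k => max_le ?_ ?_, fun k => max_le (D.not_above k) (hgQ k), fun k => le_max_left _ _,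
    fun a ha => le_antisymm (max_le (D.not_above a) (hgQ a)) (le_max_of_le_right ?_),
    fun b hb => max_eq_left (hgle fun a ha => ?_)⟩
  · refine hgle fun a ha => le_trans ?_ (hg ha)
    omega
  · exact (D.P.yCoord_succ_le k).trans (Nat.succ_le_succ (le_max_left _ _))
  · refine hgle fun a ha => ?_
    have h1 := hg (k := k) ha
    have h2 := le_max_right (D.P.yCoord k) (g k)
    omega
  · have := hg (k := a) ha
    omega
  -- If `g` lifted the path above the `NE` corner at `b - 1`, the responsible `EN` corner `a` would
  -- form a mixed pair with it.
  · by_contra! hlt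
    have := h a b ha hb (by omega)
    omega

namespace IsCornerPath

variable {R : ℕ → ℕ}

theorem mono (hR : D.IsCornerPath R) {j k : ℕ} (h : j ≤ k) : R j ≤ R k :=
  monotone_nat_of_le_succ hR.le_succ h

theorem zero (hR : D.IsCornerPath R) : R 0 = 0 := by
  have := hR.le_Q 0
  simpa using this

theorem eq_r (hR : D.IsCornerPath R) {k : ℕ} (hk : D.n ≤ k) : R k = D.r := by
  have h1 := hR.le_Q k
  have h2 := hR.P_le k
  rw [D.yQ_of_le hk] at h1
  rw [D.yP_of_le hk] at h2
  omega

/-- The positions of the north steps of the corner path. -/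
def norths (_ : D.IsCornerPath R) : Finset ℕ :=
  (Finset.Ioc 0 D.n).filter fun x => R x = R (x - 1) + 1

theorem mem_norths (hR : D.IsCornerPath R) {x : ℕ} :
    x ∈ hR.norths ↔ (1 ≤ x ∧ x ≤ D.n) ∧ R x = R (x - 1) + 1 := by
  simp [norths, Nat.one_le_iff_ne_zero, Nat.pos_iff_ne_zero]

theorem lt_of_mem_norths (hR : D.IsCornerPath R) {x k : ℕ} (hx : x ∈ hR.norths) (hk : k < x) :
    R k < R x := by
  have h1 := (hR.mem_norths.1 hx).2
  have := hR.mono (show k ≤ x - 1 by omega)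
  omega

theorem countLE_norths (hR : D.IsCornerPath R) {k : ℕ} : countLE hR.norths k = R k := by
  induction k with
  | zero => rw [countLE_zero fun x hx => (hR.mem_norths.1 hx).1.1, hR.zero]
  | succ k ih =>
    rw [countLE_succ, ih]
    have h1 := hR.le_succ k
    have h2 := hR.succ_le k
    split_ifs with hs <;> rw [hR.mem_norths] at hs <;> simp only [Nat.add_sub_cancel] at hs
    · omega
    · by_cases hk : k + 1 ≤ D.n
      · omega
      · rw [hR.eq_r (show D.n ≤ k by omega), hR.eq_r (show D.n ≤ k + 1 by omega), add_zero]

theorem card_norths (hR : D.IsCornerPath R) : hR.norths.card = D.r := by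
  rw [← countLE_eq_card fun x hx => (hR.mem_norths.1 hx).1.2, hR.countLE_norths, hR.eq_r le_rfl]

theorem exists_north (hR : D.IsCornerPath R) {i : ℕ} (hi : i < D.r) :
    ∃ x ∈ hR.norths, R x = i + 1 := by
  obtain ⟨x, hx, h, -⟩ := exists_mem_countLE_eq (S := hR.norths)
    (fun x hx => (hR.mem_norths.1 hx).1.1) (c := i + 1) (by omega) (by rw [hR.card_norths]; omega)
  exact ⟨x, hx, by rw [← hR.countLE_norths, h]⟩

/-- The fundamental presentation given by the corner path: the set of index `i` consists of the
`i`-th north step `x` of the corner path and the other steps that can be exchanged for `x`. -/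
def fundamentalSet (hR : D.IsCornerPath R) (i : ℕ) : Set ℕ :=
  {y | (1 ≤ y ∧ y ≤ D.n) ∧ (y ∈ hR.norths → R y = i + 1) ∧
    (∀ k, y ≤ k → R k ≤ i → R k ≠ D.Q.yCoord k) ∧ ∀ k, k < y → i < R k → R k ≠ D.P.yCoord k}

theorem mem_fundamentalSet_of_mem_norths (hR : D.IsCornerPath R) {x : ℕ} (hx : x ∈ hR.norths) :
    x ∈ hR.fundamentalSet (R x - 1) := by
  have h := hR.mem_norths.1 hx
  refine ⟨h.1, fun _ => by omega, fun k hk hRk => ?_, fun k hk hRk => ?_⟩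
  · have := hR.mono hk
    omega
  · have := hR.lt_of_mem_norths hx hk
    omega

theorem injOn_norths (hR : D.IsCornerPath R) : Set.InjOn R (hR.norths : Set ℕ) := by
  intro x hx y hy hxy
  by_contra hne
  rcases lt_or_gt_of_ne hne with h | h
  · exact (hR.lt_of_mem_norths hy h).ne hxy
  · exact (hR.lt_of_mem_norths hx h).ne hxy.symm

theorem isPartialTransversal_norths (hR : D.IsCornerPath R) :
    IsPartialTransversal (fun i : Fin D.r => hR.fundamentalSet i) (hR.norths : Set ℕ) := by
  refine (isPartialTransversal_fin_iff _).2 ⟨fun x => R x - 1, fun x hx y hy hxy => ?_,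
    fun x hx => ⟨?_, hR.mem_fundamentalSet_of_mem_norths hx⟩⟩
  · have h1 := (hR.mem_norths.1 hx).2
    have h2 := (hR.mem_norths.1 hy).2
    simp only at hxy
    exact hR.injOn_norths hx hy (by omega)
  · have h1 := (hR.mem_norths.1 hx)
    have h2 := hR.mono h1.1.2
    rw [hR.eq_r le_rfl] at h2
    dsimp only
    omega

/-- At a corner `R` touches the boundary path, so the no-contact conditions confine elements up to
an `EN` corner `a` to indices below `Q(a)`, and elements after an `NE` corner of `P` to indices at
or above its height. Counting gives the path conditions at the corners, which suffice. -/
theorem indep_of_isPartialTransversal_of_card (hR : D.IsCornerPath R) {S : Finset ℕ}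
    (hS : IsPartialTransversal (fun i : Fin D.r => hR.fundamentalSet i) (S : Set ℕ))
    (hcard : S.card = D.r) : D.matroid.Indep (S : Set ℕ) := by
  obtain ⟨φ, hφ, h⟩ := (isPartialTransversal_fin_iff _).1 hS
  have hS1 : ∀ x ∈ S, 1 ≤ x := fun x hx => (h x hx).2.1.1
  have hSn : ∀ x ∈ S, x ≤ D.n := fun x hx => (h x hx).2.1.2
  refine indep_of_countLE hS1 (le_countLE_of_isNECorner hSn hcard fun b hb => ?_)
    (countLE_le_of_isENCorner hS1 hcard.le fun a ha => ?_)
  · have := card_le_countLE_add (k := b - 1) (y := D.P.yCoord (b - 1)) (r := D.r) hφ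
      (fun x hx hkx => by
        by_contra! hlt
        exact (h x hx).2.2.2.2 (b - 1) hkx (by rwa [hR.eq_P b hb]) (hR.eq_P b hb))
      (fun x hx => (h x hx).1)
    have := D.yP_le_r (b - 1)
    omega
  · have := Finset.card_le_card_of_injOn (s := S.filter (· ≤ a))
      (t := Finset.range (D.Q.yCoord a)) φ
      (fun x hx => by
        rw [Finset.mem_coe, Finset.mem_filter] at hx
        rw [Finset.mem_coe, Finset.mem_range]
        by_contra! hlt
        exact (h x hx.1).2.2.2.1 a hx.2 (by rwa [hR.eq_Q a ha]) (hR.eq_Q a ha))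
      (hφ.mono fun x hx => Finset.filter_subset _ _ hx)
    rwa [Finset.card_range] at this

/-- With `N` the north steps of `R`, match the `j`-th element of `S \ N` with the `j`-th of `N \ S`.
At every `k` between partners, the path of `S` is strictly above or strictly below `R`, so `R` does
not touch the boundary path on that side. -/
theorem isPartialTransversal_of_indep_of_card (hR : D.IsCornerPath R) {S : Finset ℕ}
    (hS : D.matroid.Indep (S : Set ℕ)) (hcard : S.card = D.r) :
    IsPartialTransversal (fun i : Fin D.r => hR.fundamentalSet i) (S : Set ℕ) := by
  classical
  have hSE : ∀ x ∈ S, 1 ≤ x ∧ x ≤ D.n := fun x hx => hS.subset_ground hx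
  have hP := le_countLE_of_indep hS hcard
  have hQ := countLE_le_of_indep hS
  have hdiff := fun k => hR.countLE_norths (k := k) ▸ countLE_add_countLE_sdiff S hR.norths k
  have hVcard : (hR.norths \ S).card = (S \ hR.norths).card := by
    have h := hdiff D.n
    rw [hR.eq_r le_rfl, countLE_eq_card fun x hx => (hSE x hx).2,
      countLE_eq_card fun x hx => (hSE x (Finset.mem_sdiff.1 hx).1).2,
      countLE_eq_card fun x hx => (hR.mem_norths.1 (Finset.mem_sdiff.1 hx).1).1.2] at h
    omega
  have hex : ∀ x, ∃ z, x ∈ S \ hR.norths → z ∈ hR.norths \ S ∧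
      countLE (hR.norths \ S) z = countLE (S \ hR.norths) x ∧
      ∀ k < z, countLE (hR.norths \ S) k < countLE (S \ hR.norths) x := by
    intro x
    by_cases hx : x ∈ S \ hR.norths
    · have h0 := countLE_lt_of_mem hx (hSE x (Finset.mem_sdiff.1 hx).1).1
      obtain ⟨z, hz⟩ := exists_mem_countLE_eq (S := hR.norths \ S)
        (fun x hx => (hR.mem_norths.1 (Finset.mem_sdiff.1 hx).1).1.1)
        (c := countLE (S \ hR.norths) x) (by omega)
        (by rw [hVcard]; exact countLE_le_card _ _)
      exact ⟨z, fun _ => hz⟩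
    · exact ⟨0, fun h => absurd h hx⟩
  choose m hm using hex
  let ψ : ℕ → ℕ := fun x => if x ∈ hR.norths then x else m x
  have hψ1 : ∀ x ∈ hR.norths, ψ x = x := fun x hx => if_pos hx
  have hψ2 : ∀ x ∉ hR.norths, ψ x = m x := fun x hx => if_neg hx
  have hψN : ∀ x ∈ S, ψ x ∈ hR.norths := by
    intro x hx
    by_cases hxB : x ∈ hR.norths
    · rwa [hψ1 x hxB]
    · rw [hψ2 x hxB]
      exact (Finset.mem_sdiff.1 (hm x (Finset.mem_sdiff.2 ⟨hx, hxB⟩)).1).1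
  have hψinj : Set.InjOn ψ (S : Set ℕ) := by
    intro x hx y hy hxy
    by_cases hxB : x ∈ hR.norths <;> by_cases hyB : y ∈ hR.norths
    · rwa [hψ1 x hxB, hψ1 y hyB] at hxy
    · rw [hψ1 x hxB, hψ2 y hyB] at hxy
      exact absurd hx (hxy ▸ (Finset.mem_sdiff.1 (hm y (Finset.mem_sdiff.2 ⟨hy, hyB⟩)).1).2)
    · rw [hψ1 y hyB, hψ2 x hxB] at hxy
      exact absurd hy (hxy ▸ (Finset.mem_sdiff.1 (hm x (Finset.mem_sdiff.2 ⟨hx, hxB⟩)).1).2)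
    · rw [hψ2 x hxB, hψ2 y hyB] at hxy
      have hxU := Finset.mem_sdiff.2 ⟨hx, hxB⟩
      have hyU := Finset.mem_sdiff.2 ⟨hy, hyB⟩
      have h1 := (hm x hxU).2.1
      rw [hxy, (hm y hyU).2.1] at h1
      by_contra hne
      rcases lt_or_gt_of_ne hne with h | h
      · have := countLE_lt_of_mem hyU h
        omega
      · have := countLE_lt_of_mem hxU h
        omega
  obtain ⟨φ, hφ, h⟩ := (isPartialTransversal_fin_iff _).1 hR.isPartialTransversal_norths
  refine (isPartialTransversal_fin_iff _).2 ⟨fun x => φ (ψ x),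
    hφ.comp hψinj hψN, fun x hx => ⟨(h _ (hψN x hx)).1, ?_⟩⟩
  dsimp only
  by_cases hxB : x ∈ hR.norths
  · rw [hψ1 x hxB]
    exact (h x hxB).2
  · have hxU := Finset.mem_sdiff.2 ⟨hx, hxB⟩
    obtain ⟨hz, hzc, hzlt⟩ := hm x hxU
    have hzB := (Finset.mem_sdiff.1 hz).1
    -- A north step lies in only one of the sets, so `φ` has no choice: `R (m x) = φ (m x) + 1`.
    have hφz := (h _ hzB).2.2.1 hzB
    rw [hψ2 x hxB]
    -- The height conditions say `x ≤ k < m x` and `m x ≤ k < x` respectively. There one of `S \ N`,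
    -- `N \ S` is strictly ahead in the count, so `S` would leave the region at a contact.
    refine ⟨hSE x hx, fun hx' => absurd hx' hxB, fun k hk hRk => ?_, fun k hk hRk => ?_⟩
    · have h1 : k < m x := by
        by_contra! hcon
        have := hR.mono hcon
        omega
      have h2 := hzlt k h1
      have h3 := countLE_mono (S \ hR.norths) hk
      have h4 := hdiff k
      have h5 := hQ k
      omega
    · have h1 : m x ≤ k := by
        by_contra! hcon
        have := hR.lt_of_mem_norths hzB hcon
        omega
      have h2 := countLE_mono (hR.norths \ S) h1
      have h3 := countLE_lt_of_mem hxU hk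
      have h4 := hdiff k
      have h5 := hP k
      omega

theorem ncard_norths (hR : D.IsCornerPath R) : (hR.norths : Set ℕ).ncard = D.r := by
  rw [Set.ncard_coe_finset, hR.card_norths]

/-- It is enough to compare sets of size `r`: either kind of partial transversal extends to one, by
augmenting from the north steps of `Q` or of `R`. -/
theorem isPresentation (hR : D.IsCornerPath R) :
    D.matroid.IsPresentation fun i : Fin D.r => hR.fundamentalSet i := by
  have hle : ∀ {I : Set ℕ} {A : Fin D.r → Set ℕ}, IsPartialTransversal A I → I.ncard ≤ D.r := by
    rintro I A ⟨φ, hφ, -⟩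
    have := Nat.card_le_card_of_injective φ hφ
    rwa [Nat.card_coe_set_eq, Nat.card_eq_fintype_card, Fintype.card_fin] at this
  refine ⟨fun i x hx => hx.1, fun I => ⟨fun hI => ?_, fun hI => ?_⟩⟩
  · have hIfin : I.Finite := (Set.finite_Icc 1 D.n).subset hI.subset_ground
    have hQn : (D.Q.norths 0 D.n : Set ℕ).ncard = D.r := by
      have := LatticePath.card_norths_add (w := D.Q) (Nat.zero_le D.n)
      rw [D.yQ_of_le le_rfl, LatticePath.yCoord_zero] at this
      rw [Set.ncard_coe_finset]
      omega
    obtain ⟨S, hIS, hSs, hS, hSt⟩ := IsPartialTransversal.exists_superset hIfin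
      hI.2 (D.indep_norths_Q D.n).2 (by rw [hQn]; exact hle hI.2)
    have hSfin : S.Finite := (hIfin.union (Finset.finite_toSet _)).subset hSs
    lift S to Finset ℕ using hSfin
    rw [hQn, Set.ncard_coe_finset] at hS
    have hSI : D.matroid.Indep (S : Set ℕ) :=
      ⟨hSs.trans (Set.union_subset hI.subset_ground (D.indep_norths_Q D.n).subset_ground), hSt⟩
    exact (hR.isPartialTransversal_of_indep_of_card hSI hS).subset hIS
  · have hIfin : I.Finite := by
      obtain ⟨φ, hφ, h⟩ := (isPartialTransversal_fin_iff _).1 hI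
      exact (Set.finite_Icc 1 D.n).subset fun x hx => (h x hx).2.1
    obtain ⟨S, hIS, hSs, hS, hSt⟩ := IsPartialTransversal.exists_superset hIfin
      hI hR.isPartialTransversal_norths
      (by rw [hR.ncard_norths]; exact hle hI)
    have hSfin : S.Finite := (hIfin.union (Finset.finite_toSet _)).subset hSs
    lift S to Finset ℕ using hSfin
    rw [hR.ncard_norths, Set.ncard_coe_finset] at hS
    exact (hR.indep_of_isPartialTransversal_of_card hSt hS).subset hIS

theorem isFundamentalTransversal (hR : D.IsCornerPath R) :
    D.matroid.IsFundamentalTransversal := by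
  refine ⟨D.r, _, hR.isPresentation, fun i => ?_⟩
  obtain ⟨x, hx, hxi⟩ := hR.exists_north i.2
  refine ⟨x, ?_, fun j hj hxj => hj (Fin.ext ?_)⟩
  · have := hR.mem_fundamentalSet_of_mem_norths hx
    rwa [hxi] at this
  · have := hxj.2.1 hx
    omega

end IsCornerPath

end LatticePathPair

/-! ### Segments between meeting points as connected components -/

namespace LatticePath

/-- The `min` admits `k` beyond the end of the segment, as the field `not_above` of a path pair
demands. -/
theorem count_segment (w : LatticePath) (c : LatticeStep) {s t : ℕ} (hst : s ≤ t) (k : ℕ) :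
    (((w.take t).drop s).take k).count c + (w.take s).count c =
      (w.take (min (s + k) t)).count c := by
  rw [← List.take_take, List.take_add, List.count_append, List.take_take, min_eq_left hst,
    add_comm]

theorem yCoord_segment (w : LatticePath) {s t : ℕ} (hst : s ≤ t) (k : ℕ) :
    yCoord ((w.take t).drop s) k + w.yCoord s = w.yCoord (min (s + k) t) :=
  count_segment w _ hst k

theorem count_drop_take (w : LatticePath) (c : LatticeStep) {s t : ℕ} (hst : s ≤ t) :
    ((w.take t).drop s).count c + (w.take s).count c = (w.take t).count c := by
  have h := count_segment w c hst t
  rwa [List.take_of_length_le (by simp), min_eq_right (by omega)] at h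

theorem step_segment (w : LatticePath) {s t k : ℕ} (hk : 1 ≤ k) (hkt : s + k ≤ t) :
    step ((w.take t).drop s) k = w.step (s + k) := by
  rw [step_of_one_le hk, step_of_one_le (by omega), List.getElem?_drop, List.getElem?_take,
    if_pos (by omega)]
  congr 1
  omega

end LatticePath

namespace LatticePathPair

variable {D : LatticePathPair}

theorem xCoord_eq_of_meet {k : ℕ} (hkn : k ≤ D.n) (hk : D.P.yCoord k = D.Q.yCoord k) :
    D.P.xCoord k = D.Q.xCoord k := by
  have h1 := LatticePath.xCoord_add_yCoord (w := D.P) (k := k) hkn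
  have h2 := LatticePath.xCoord_add_yCoord (w := D.Q) (k := k) (by rwa [D.length_Q])
  omega

/-- The part of a pair of lattice paths between two points in which the paths meet. -/
def segment (D : LatticePathPair) (s t : ℕ) (hst : s ≤ t) (htn : t ≤ D.n)
    (hs : D.P.yCoord s = D.Q.yCoord s) (ht : D.P.yCoord t = D.Q.yCoord t) : LatticePathPair where
  P := (D.P.take t).drop s
  Q := (D.Q.take t).drop s
  count_E_eq := by
    have h1 := D.P.count_drop_take LatticeStep.E hst
    have h2 := D.Q.count_drop_take LatticeStep.E hst
    have h3 := xCoord_eq_of_meet (hst.trans htn) hs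
    have h4 := xCoord_eq_of_meet htn ht
    unfold LatticePath.xCoord at h3 h4
    omega
  count_N_eq := by
    have h1 := D.P.count_drop_take LatticeStep.N hst
    have h2 := D.Q.count_drop_take LatticeStep.N hst
    unfold LatticePath.yCoord at hs ht
    omega
  not_above k := by
    have h1 := D.P.yCoord_segment hst k
    have h2 := D.Q.yCoord_segment hst k
    have h3 := D.not_above (min (s + k) t)
    omega

section Segment

variable {s t : ℕ} {hst : s ≤ t} {htn : t ≤ D.n} {hs : D.P.yCoord s = D.Q.yCoord s}
  {ht : D.P.yCoord t = D.Q.yCoord t}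

theorem segment_n : (D.segment s t hst htn hs ht).n = t - s := by
  have : t ≤ D.P.length := htn
  simp [n, segment, this]

theorem segment_yP {k : ℕ} (hk : s + k ≤ t) :
    (D.segment s t hst htn hs ht).P.yCoord k + D.P.yCoord s = D.P.yCoord (s + k) := by
  have := D.P.yCoord_segment hst k
  rwa [min_eq_left hk] at this

theorem segment_yQ {k : ℕ} (hk : s + k ≤ t) :
    (D.segment s t hst htn hs ht).Q.yCoord k + D.P.yCoord s = D.Q.yCoord (s + k) := by
  have := D.Q.yCoord_segment hst k
  rwa [min_eq_left hk, ← hs] at this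

/-- Positions shift by `s` and indices by the common height of the paths at `s`. -/
theorem segment_indep_iff {I : Set ℕ} (hI : I ⊆ Set.Icc 1 (t - s)) :
    (D.segment s t hst htn hs ht).matroid.Indep I ↔ D.matroid.Indep ((s + ·) '' I) := by
  have hinj : Function.Injective (s + ·) := add_right_injective s
  have hPQ : ∀ x ∈ I, 1 ≤ x ∧
      (D.segment s t hst htn hs ht).P.yCoord (x - 1) + D.P.yCoord s = D.P.yCoord (s + x - 1) ∧
      (D.segment s t hst htn hs ht).Q.yCoord x + D.P.yCoord s = D.Q.yCoord (s + x) := by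
    intro x hx
    have h := hI hx
    rw [Set.mem_Icc] at h
    refine ⟨h.1, ?_, segment_yQ (by omega)⟩
    rw [segment_yP (by omega)]
    congr 1
    omega
  rw [indep_iff, indep_iff]
  constructor
  · rintro ⟨φ, hφ, h⟩
    refine ⟨fun x => φ (x - s) + D.P.yCoord s, ?_, ?_⟩
    · rintro _ ⟨x, hx, rfl⟩ _ ⟨y, hy, rfl⟩ hxy
      simp only [Nat.add_sub_cancel_left, Nat.add_right_cancel_iff] at hxy
      simp only [hφ hx hy hxy]
    · rintro _ ⟨x, hx, rfl⟩
      have h1 := hPQ x hx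
      have h2 := h x hx
      simp only [Nat.add_sub_cancel_left]
      omega
  · rintro ⟨φ, hφ, h⟩
    have hle : ∀ x ∈ I, D.P.yCoord s ≤ φ (s + x) := fun x hx => by
      have h1 := hPQ x hx
      have h2 := h _ (Set.mem_image_of_mem _ hx)
      omega
    refine ⟨fun x => φ (s + x) - D.P.yCoord s, fun x hx y hy hxy => ?_, fun x hx => ?_⟩
    · have h1 := hle x hx
      have h2 := hle y hy
      simp only at hxy
      exact hinj (hφ (Set.mem_image_of_mem _ hx) (Set.mem_image_of_mem _ hy)
        (by dsimp only; omega))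
    · have h1 := hPQ x hx
      have h2 := h _ (Set.mem_image_of_mem _ hx)
      have h3 := hle x hx
      dsimp only at h2 ⊢
      omega

theorem segment_isSeparated (h : ∀ k, s < k → k < t → D.P.yCoord k ≠ D.Q.yCoord k) :
    (D.segment s t hst htn hs ht).IsSeparated := by
  intro k hk hkn
  rw [segment_n] at hkn
  have h1 := segment_yP (hst := hst) (htn := htn) (hs := hs) (ht := ht) (k := k) (by omega)
  have h2 := segment_yQ (hst := hst) (htn := htn) (hs := hs) (ht := ht) (k := k) (by omega)
  have h3 := h (s + k) (by omega) (by omega)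
  have h4 := D.not_above (s + k)
  omega

theorem segment_isENCorner {a : ℕ} (ha : D.IsENCorner a) (hsa : s < a) (hat : a < t) :
    (D.segment s t hst htn hs ht).IsENCorner (a - s) := by
  have h1 := D.Q.step_segment (s := s) (t := t) (k := a - s) (by omega) (by omega)
  have h2 := D.Q.step_segment (s := s) (t := t) (k := a - s + 1) (by omega) (by omega)
  rw [show s + (a - s) = a by omega] at h1
  rw [show s + (a - s + 1) = a + 1 by omega] at h2
  exact ⟨h1.trans ha.1, h2.trans ha.2⟩

theorem segment_isNECorner {b : ℕ} (hb : D.IsNECorner b) (hsb : s < b - 1) (hbt : b - 1 < t) :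
    (D.segment s t hst htn hs ht).IsNECorner (b - s) := by
  have h1 := D.P.step_segment (s := s) (t := t) (k := b - s - 1) (by omega) (by omega)
  have h2 := D.P.step_segment (s := s) (t := t) (k := b - s) (by omega) (by omega)
  rw [show s + (b - s - 1) = b - 1 by omega] at h1
  rw [show s + (b - s) = b by omega] at h2
  exact ⟨h1.trans hb.1, h2.trans hb.2⟩

end Segment

/-- Separation makes the first step of `Q` north and the last one east. So `1` lies in the circuit
of every east step of `Q`, and a north step `k` lies in the circuit of the last step. -/
theorem IsSeparated.exists_isCircuit_one_mem (hD : D.IsSeparated) {k : ℕ} (h2 : 2 ≤ k)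
    (hk : k ≤ D.n) : ∃ C, D.matroid.IsCircuit C ∧ 1 ∈ C ∧ k ∈ C := by
  have h1 := hD 1 one_pos (by omega)
  have h1' := D.Q.yCoord_succ_le 0
  rw [zero_add, LatticePath.yCoord_zero] at h1'
  have hone : ∀ g, 2 ≤ g → 1 ∈ insert g (D.Q.norths 0 (g - 1) : Set ℕ) := fun g hg => by
    refine Or.inr ?_
    rw [Finset.mem_coe, LatticePath.mem_norths, Nat.sub_self, LatticePath.yCoord_zero]
    omega
  by_cases hkE : D.Q.yCoord k = D.Q.yCoord (k - 1)
  · exact ⟨_, hD.isCircuit_insert_norths_Q (by omega) hk hkE, hone k h2, Set.mem_insert _ _⟩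
  · have hlast : D.Q.yCoord D.n = D.Q.yCoord (D.n - 1) := by
      have h3 := hD (D.n - 1) (by omega) (by omega)
      have h4 := D.P.yCoord_succ_le (D.n - 1)
      have h5 := D.yQ_le_r (D.n - 1)
      rw [Nat.sub_add_cancel (by omega), D.yP_of_le le_rfl] at h4
      rw [D.yQ_of_le le_rfl]
      omega
    refine ⟨_, hD.isCircuit_insert_norths_Q (by omega) le_rfl hlast, hone _ (by omega), Or.inr ?_⟩
    have hkn : k ≠ D.n := by rintro rfl; exact hkE hlast
    have h3 := D.Q.yCoord_succ_le (k - 1)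
    have h4 := D.Q.yCoord_le_succ (k - 1)
    rw [Nat.sub_add_cancel (by omega)] at h3 h4
    rw [Finset.mem_coe, LatticePath.mem_norths]
    omega

/-- Heights are monotone and rise by at most one per step. A meeting point between the corners would
give `Q(a) ≤ P(b-1)` if `a ≤ b - 1`, and `Q(a) ≤ P(b-1) + (a - (b-1))` otherwise. -/
theorem yP_ne_yQ_of_isMixed {a b k : ℕ} (h1 : D.P.yCoord (b - 1) < D.Q.yCoord a)
    (h2 : a + D.P.yCoord (b - 1) < b - 1 + D.Q.yCoord a) (hk : min a (b - 1) ≤ k)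
    (hk' : k ≤ max a (b - 1)) : D.P.yCoord k ≠ D.Q.yCoord k := by
  intro heq
  have h3 := D.P.yCoord_le_add_sub k (b - 1)
  have h4 := D.Q.yCoord_le_add_sub a k
  have h5 : k ≤ b - 1 → D.P.yCoord k ≤ D.P.yCoord (b - 1) := D.P.yCoord_le
  have h6 : a ≤ k → D.Q.yCoord a ≤ D.Q.yCoord k := D.Q.yCoord_le
  omega

end LatticePathPair

theorem isPartialTransversal_image_iff {α β ι : Type*} {f : α → β} {E : Set α} (hf : Set.InjOn f E)
    {A : ι → Set α} (hA : ∀ i, A i ⊆ E) {I : Set α} (hI : I ⊆ E) :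
    IsPartialTransversal (fun i => f '' A i) (f '' I) ↔ IsPartialTransversal A I := by
  constructor
  · rintro ⟨φ, hφ, h⟩
    refine ⟨fun x => φ ⟨f x, Set.mem_image_of_mem f x.2⟩, fun x y hxy => ?_, fun x => ?_⟩
    · exact Subtype.ext (hf (hI x.2) (hI y.2) (congrArg Subtype.val (hφ hxy)))
    · exact (hf.mem_image_iff (hA _) (hI x.2)).1 (h ⟨f x, Set.mem_image_of_mem f x.2⟩)
  · rintro ⟨φ, hφ, h⟩
    choose g hgI hg using fun y : f '' I => y.2
    refine ⟨fun y => φ ⟨g y, hgI y⟩, fun x y hxy => Subtype.ext ?_, fun y => ?_⟩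
    · rw [← hg x, ← hg y]
      exact congrArg f (congrArg Subtype.val (hφ hxy))
    · exact ⟨g y, h ⟨g y, hgI y⟩, hg y⟩

namespace Matroid

variable {α : Type*}

theorem isFundamentalTransversal_of_isEmpty [IsEmpty α] (M : Matroid α) :
    M.IsFundamentalTransversal := by
  refine ⟨0, fun i => i.elim0, ⟨fun i => i.elim0, fun I => ?_⟩, fun i => i.elim0⟩
  rw [Set.eq_empty_of_isEmpty I]
  exact iff_of_true M.empty_indep (IsPartialTransversal.empty _)

variable [LinearOrder α] {M : Matroid α} {D : LatticePathPair} {f : ℕ → α}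

theorem IsLabelling.isFundamentalTransversal (h : M.IsLabelling D f)
    (hD : D.matroid.IsFundamentalTransversal) : M.IsFundamentalTransversal := by
  obtain ⟨r, A, ⟨hAE, hA⟩, hpriv⟩ := hD
  have hinj := h.strictMonoOn.injOn
  refine ⟨r, fun i => f '' A i, ⟨fun i => ?_, fun I => ?_⟩, fun i => ?_⟩
  · rw [← h.image_eq]
    exact Set.image_mono (hAE i)
  · constructor
    · intro hI
      obtain ⟨J, hJ, rfl⟩ := h.exists_eq_image hI.subset_ground
      rwa [isPartialTransversal_image_iff hinj hAE hJ, ← hA, h.indep_iff J hJ]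
    · intro hI
      have hIE : I ⊆ M.E := fun x hx => by
        obtain ⟨φ, -, hφ⟩ := hI
        rw [← h.image_eq]
        exact Set.image_mono (hAE _) (hφ ⟨x, hx⟩)
      obtain ⟨J, hJ, rfl⟩ := h.exists_eq_image hIE
      rwa [isPartialTransversal_image_iff hinj hAE hJ, ← hA, h.indep_iff J hJ] at hI
  · obtain ⟨x, hx, hxj⟩ := hpriv i
    exact ⟨f x, Set.mem_image_of_mem f hx, fun j hj hxf =>
      hxj j hj ((hinj.mem_image_iff (hAE j) (hAE i hx)).1 hxf)⟩

section Segment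

variable {s t : ℕ} {hst : s ≤ t} {htn : t ≤ D.n} {hs : D.P.yCoord s = D.Q.yCoord s}
  {ht : D.P.yCoord t = D.Q.yCoord t}

theorem IsLabelling.restrict_segment (h : M.IsLabelling D f) :
    (M ↾ (f '' Set.Ioc s t)).IsLabelling (D.segment s t hst htn hs ht) fun k => f (s + k) := by
  have hsub : ∀ x ∈ Set.Icc 1 (t - s), s + x ∈ Set.Icc 1 D.n := fun x hx => by
    rw [Set.mem_Icc] at hx ⊢
    omega
  have himage : (s + ·) '' Set.Icc 1 (t - s) = Set.Ioc s t := by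
    ext x
    simp only [Set.mem_image, Set.mem_Icc, Set.mem_Ioc]
    exact ⟨by rintro ⟨k, hk, rfl⟩; omega, fun hx => ⟨x - s, by omega, by omega⟩⟩
  refine ⟨?_, ?_, ?_⟩ <;> rw [LatticePathPair.segment_n]
  · exact fun x hx y hy hxy => h.strictMonoOn (hsub x hx) (hsub y hy) (Nat.add_lt_add_left hxy s)
  · rw [← Set.image_image f (s + ·), himage]
    rfl
  · intro I hI
    have hI' : (s + ·) '' I ⊆ Set.Icc 1 D.n := by
      rintro _ ⟨x, hx, rfl⟩
      exact hsub x (hI hx)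
    rw [LatticePathPair.segment_indep_iff hI, h.indep_iff _ hI', Set.image_image,
      restrict_indep_iff, ← Set.image_image f (s + ·), ← himage]
    exact ⟨fun h => ⟨h, Set.image_mono (Set.image_mono hI)⟩, fun h => h.1⟩

theorem IsLabelling.isConnectedComponent_image_Ioc (h : M.IsLabelling D f) (hlt : s < t)
    (htn : t ≤ D.n) (hs : D.P.yCoord s = D.Q.yCoord s) (ht : D.P.yCoord t = D.Q.yCoord t)
    (hne : ∀ k, s < k → k < t → D.P.yCoord k ≠ D.Q.yCoord k) :
    M.IsConnectedComponent (f '' Set.Ioc s t) := by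
  have h1 : s + 1 ∈ Set.Icc 1 D.n := ⟨by omega, by omega⟩
  have hsub : Set.Ioc s t ⊆ Set.Icc 1 D.n := fun x hx => ⟨by have := hx.1; omega, hx.2.trans htn⟩
  have hE : f '' Set.Ioc s t ⊆ M.E := h.image_eq ▸ Set.image_mono hsub
  refine ⟨f (s + 1), h.image_eq ▸ Set.mem_image_of_mem f h1, subset_antisymm ?_ ?_⟩
  · rintro _ ⟨x, hx, rfl⟩
    refine ⟨hE (Set.mem_image_of_mem f hx), ?_⟩
    rw [Set.mem_Ioc] at hx
    by_cases hx1 : x = s + 1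
    · exact Or.inl (by rw [hx1])
    · have hseg := h.restrict_segment (hst := hlt.le) (htn := htn) (hs := hs) (ht := ht)
      obtain ⟨C, hC, h1C, hxC⟩ := (LatticePathPair.segment_isSeparated (hst := hlt.le)
        (htn := htn) (hs := hs) (ht := ht) hne).exists_isCircuit_one_mem (k := x - s)
        (by omega) (by rw [LatticePathPair.segment_n]; omega)
      refine Or.inr ⟨_, ((restrict_isCircuit_iff hE).1
        ((hseg.isCircuit_iff hC.subset_ground).1 hC)).1, ⟨1, h1C, rfl⟩, x - s, hxC, ?_⟩
      dsimp only
      congr 1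
      omega
  · rintro y ⟨hyE, hy⟩
    rw [← h.image_eq] at hyE
    obtain ⟨j, hj, rfl⟩ := hyE
    rcases hy with heq | ⟨C, hC, hsC, hjC⟩
    · rw [← heq]
      exact ⟨s + 1, ⟨by omega, by omega⟩, rfl⟩
    · refine ⟨j, ⟨?_, h.le_of_isCircuit hC ht h1 hj hsC hjC (by omega)⟩, rfl⟩
      by_contra! hjs
      have := h.le_of_isCircuit hC hs hj h1 hjC hsC hjs
      omega

end Segment

theorem IsLabelling.not_exists_isMixedPair (h : M.IsLabelling D f)
    (hM : ∀ X : Set α, M.IsConnectedComponent X → ¬ (M ↾ X).HasMixedPair) :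
    ¬ ∃ A B, D.IsMixedPair A B := by
  classical
  rw [LatticePathPair.exists_isMixedPair_iff]
  rintro ⟨a, b, ha, hb, h1, h2⟩
  have hmeet := fun k => LatticePathPair.yP_ne_yQ_of_isMixed (k := k) h1 h2
  have han := ha.lt_n
  have hbn := hb.le_n
  have hb2 := hb.two_le
  let p : ℕ → Prop := fun k => D.P.yCoord k = D.Q.yCoord k
  have hp0 : p 0 := by simp [p]
  have hpn : p D.n := by simp only [p]; rw [D.yP_of_le le_rfl, D.yQ_of_le le_rfl]
  set m := min a (b - 1) with hm
  set m' := max a (b - 1) with hm'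
  have hmm' : m ≤ m' := min_le_max
  have hex : ∃ k, m ≤ k ∧ p k := ⟨D.n, by omega, hpn⟩
  -- The component is cut out by the last meeting point `s` up to both corners and the first meeting
  -- point `t` from the earlier corner on; no meeting occurs between the corners, so both lie
  -- strictly inside.
  have hs : p (Nat.findGreatest p m) := Nat.findGreatest_spec (Nat.zero_le m) hp0
  have hsm : Nat.findGreatest p m ≤ m := Nat.findGreatest_le m
  have hsmax : ∀ k, Nat.findGreatest p m < k → k ≤ m → ¬ p k := fun k hk hkm =>
    Nat.findGreatest_is_greatest hk hkm
  have htmin : ∀ k, m ≤ k → k < Nat.find hex → ¬ p k := fun k hk hkt hpk =>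
    Nat.find_min hex hkt ⟨hk, hpk⟩
  have htn : Nat.find hex ≤ D.n := Nat.find_min' hex ⟨by omega, hpn⟩
  obtain ⟨htm, ht⟩ := Nat.find_spec hex
  generalize Nat.findGreatest p m = s at hs hsm hsmax
  generalize Nat.find hex = t at htmin htn htm ht
  have hsm' : s < m := lt_of_le_of_ne hsm fun heq => hmeet s heq.ge (by omega) hs
  have htm' : m' < t := by
    by_contra! hcon
    exact hmeet t htm hcon ht
  have hne : ∀ k, s < k → k < t → D.P.yCoord k ≠ D.Q.yCoord k := fun k hsk hkt => by
    rcases le_total k m with hkm | hkm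
    · exact hsmax k hsk hkm
    · exact htmin k hkm hkt
  have hst : s ≤ t := by omega
  refine hM _ (h.isConnectedComponent_image_Ioc (by omega) htn hs ht hne)
    ⟨D.segment s t hst htn hs ht, h.restrict_segment.isLatticePathMatroidOf,
      LatticePathPair.exists_isMixedPair_iff.2 ⟨a - s, b - s,
        LatticePathPair.segment_isENCorner ha (by omega) (by omega),
        LatticePathPair.segment_isNECorner hb (by omega) (by omega), ?_⟩⟩
  have h3 := LatticePathPair.segment_yP (hst := hst) (htn := htn) (hs := hs) (ht := ht)
    (k := b - s - 1) (by omega)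
  have h4 := LatticePathPair.segment_yQ (hst := hst) (htn := htn) (hs := hs) (ht := ht)
    (k := a - s) (by omega)
  rw [show s + (b - s - 1) = b - 1 by omega] at h3
  rw [show s + (a - s) = a by omega] at h4
  omega

end Matroid

theorem mainTheorem4 {α : Type*} [LinearOrder α] (M : Matroid α) (hM : M.IsLatticePathMatroid) :
    List.TFAE [
      M.IsFundamentalTransversal,
      ∀ X Y : Set α, M.IsCyclicFlat X → M.IsCyclicFlat Y → M.IsModularPair X Y,
      ∀ X : Set α, M.IsConnectedComponent X → ¬ (M.restrict X).HasMixedPair] := by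
  -- A labelling is a total function on `ℕ` and needs a default value, so the empty type is treated
  -- apart.
  rcases isEmpty_or_nonempty α with hα | hα
  · refine List.tfae_of_forall True _ fun P hP => iff_true_intro ?_
    simp only [List.mem_cons, List.not_mem_nil, or_false] at hP
    rcases hP with rfl | rfl | rfl
    · exact M.isFundamentalTransversal_of_isEmpty
    · exact fun X Y => M.isFundamentalTransversal_of_isEmpty.isModularPair
    · rintro X ⟨x, -⟩
      exact hα.elim x
  obtain ⟨D, hD⟩ := hM
  obtain ⟨f, hf⟩ := hD.exists_isLabelling
  have := hf.finite
  tfae_have 1 → 2 := fun h X Y => h.isModularPair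
  tfae_have 2 → 3 := fun h X hX => hX.not_hasMixedPair h
  tfae_have 3 → 1 := fun h => by
    obtain ⟨R, hR⟩ := LatticePathPair.exists_isCornerPath (hf.not_exists_isMixedPair h)
    exact hf.isFundamentalTransversal hR.isFundamentalTransversal
  tfae_finish
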